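/- **Setting.** Let $X$ be a separable (real) Banach space with a non-degenerate centered Gaussian measure $\mu$. Let $X^*_\mu$ be the closure of $X^*$ in $L^2(X,\mu)$, $R_\mu g=\int_X g(x)\,x\,d\mu(x)$ for $g\in X^*_\mu$, and let $H=R_\mu(X^*_\mu)\subseteq X$ be the Cameron–Martin space, with the inner product that makes $R_\mu:X^*_\mu\to H$ unitary. Let $\mathcal H_2$ be the space of Hilbert–Schmidt operators on $H$, with $\|A\|_{\mathcal H_2}^2=\sum_i|Ae_i|_H^2$ for an orthonormal basis $(e_i)$ of $H$. Let $\mathscr{FC}^\infty_b(X)$ be the space of functions $f(x)=\varphi(l_1(x),\dots,l_n(x))$ with $n\in\mathbb N$, $l_i\in X^*$ and $\varphi\in C^\infty(\mathbb R^n)$ bounded together with all its derivatives, and let $\mathscr{FC}^\infty_b(X;H)$ be the linear span of the functions $x\mapsto f(x)h$ with $f\in\mathscr{FC}^\infty_b(X)$, $h\in H$. For such functions $\nabla_Hf(x)\in H$ (resp. $\nabla_HF(x)\in\mathcal H_2$) is the derivative along $H$: $\langle\nabla_H f(x),h\rangle_H=\partial_hf(x)$ (resp. $\nabla_HF(x)h=\partial_hF(x)$),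 and $\nabla_H^2f=\nabla_H(\nabla_Hf)$. For a finite Borel measure $m$ on $X$ and an exponent $a\in(0,\infty)$ we say that $f\in W^{1,a}(X,m)$ with gradient $\nabla_Hf=\Phi$ if $(f,\Phi)\in L^a(X,m)\times L^a(X,m;H)$ is the limit in this space of pairs $(f_n,\nabla_Hf_n)$ with $f_n\in\mathscr{FC}_b^\infty(X)$, and we put $\|f\|_{W^{1,a}(X,m)}=\|f\|_{L^a(X,m)}+\|\Phi\|_{L^a(X,m;H)}$ (whenever $\Phi$ is not unique, in particular possibly for $a<1$, statements and norms refer to the pair $(f,\Phi)$). $W^{1,a}(X,m;H)$ is defined in the same way from $\mathscr{FC}_b^\infty(X;H)$, with gradients in $L^a(X,m;\mathcal H_2)$; and $f\in W^{2,a}(X,m)$ if $(f,\Phi,A)$ is, for some $\Phi,A$, a limit of $(f_n,\nabla_Hf_n,\nabla_H^2f_n)$, $f_n\in\mathscr{FC}_b^\infty(X)$, in $L^a(X,m)\times L^a(X,m;H)\times L^a(X,m;\mathcal H_2)$. Let $w:X\to\mathbb R$ with $w>0$ $\mu$-a.e., $w\in W^{1,s}(X,\mu)$ for some $s>1$, and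 $\log w\in W^{1,t}(X,\mu)$ for some $t>s'$, where $\frac1s+\frac1{s'}=1$. Put $\nu:=w\mu$. A symbol $W\hookrightarrow W'$ means that every element of $W$ belongs to $W'$ with the same gradient, that the $W'$-norm is bounded by a constant times the $W$-norm, and that the map so obtained on equivalence classes is well defined and injective. **Proposition.** Let $p\ge\frac{t}{t-s'}$. Then $\nabla_H$ on $\mathscr{FC}_b^\infty(X)$ is closable in $L^p(X,\nu)$ and $\nabla_H$ on $\mathscr{FC}_b^\infty(X;H)$ is closable in $L^p(X,\nu;H)$, so that $W^{1,p}(X,\nu)$ and $W^{1,p}(X,\nu;H)$ are the domains of the closures of $\nabla_H$ (with unique gradients), normed by the graph norm; and the following hold. 1. $W^{1,p}(X,\nu)$ is reflexive. 2. For every $q\in(ps',+\infty)$, $W^{1,q}(X,\mu)\hookrightarrow W^{1,p}(X,\nu)$ and $W^{1,q}(X,\mu;H)\hookrightarrow W^{1,p}(X,\nu;H)$. In particular, if $G\in W^{2,q}(X,\mu)$ for every $q>1$, then $G\in W^{1,b}(X,\nu)$ for every $b\ge\frac t{t-s'}$. 3. If $\int_Xw^{\frac r{r-1}}d\mu<+\infty$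 for some $r\in(0,1)$, then $W^{1,p}(X,\nu)\hookrightarrow W^{1,pr}(X,\mu)$ and $W^{1,p}(X,\nu;H)\hookrightarrow W^{1,pr}(X,\mu;H)$. 4. Let $(\varphi_n)_{n\in\mathbb N}\subseteq W^{1,p}(X,\nu)$. If $\varphi_n$ converges pointwise $\nu$-a.e. to $\varphi$ and $\sup_n\|\varphi_n\|_{W^{1,p}(X,\nu)}<+\infty$, then $\varphi\in W^{1,p}(X,\nu)$. 5. Let $q\ge\frac t{t-s'}$, $\varphi\in W^{1,p}(X,\nu)$ and $\psi\in W^{1,q}(X,\nu)$. If $\frac{pq}{p+q}\ge\frac t{t-s'}$, then $\varphi\psi\in W^{1,r}(X,\nu)$ for every $r\in\left[\frac t{t-s'},\frac{pq}{p+q}\right]$, and $\nabla_H(\varphi\psi)=\varphi\nabla_H\psi+\psi\nabla_H\varphi$. -/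

import Mathlib

open MeasureTheory ProbabilityTheory Filter Topology
open scoped ENNReal NNReal ContDiff

noncomputable section

namespace WGauss

/-! ### Smooth cylindrical functions -/

section Cylindrical

variable {X : Type*} [NormedAddCommGroup X] [NormedSpace ℝ X]

/-- `f(x) = φ(l₁(x), …, lₙ(x))` with `l₁, …, lₙ ∈ X*` and `φ` smooth on `ℝⁿ`, bounded together
with all its derivatives. -/
def IsSmoothCylindrical (f : X → ℝ) : Prop :=
  ∃ (n : ℕ) (φ : (Fin n → ℝ) → ℝ) (l : Fin n → StrongDual ℝ X),
    ContDiff ℝ ∞ φ ∧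
    (∀ k : ℕ, ∃ C : ℝ, ∀ y, ‖iteratedFDeriv ℝ k φ y‖ ≤ C) ∧
    f = fun x => φ (fun i => l i x)

variable (X) in
/-- The space of `E`-valued smooth cylindrical functions: the linear span of the functions
`x ↦ f(x) e`, with `f` a real smooth cylindrical function and `e ∈ E`. For `E = ℝ` these are the
real smooth cylindrical functions (which already form a vector space). -/
def cylindrical (E : Type*) [NormedAddCommGroup E] [NormedSpace ℝ E] : Submodule ℝ (X → E) :=
  Submodule.span ℝ {F | ∃ (f : X → ℝ) (e : E), IsSmoothCylindrical f ∧ F = fun x => f x • e}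

theorem IsSmoothCylindrical.contDiff {f : X → ℝ} (hf : IsSmoothCylindrical f) :
    ContDiff ℝ ∞ f := by
  obtain ⟨n, φ, l, hφ, -, rfl⟩ := hf
  exact hφ.comp (contDiff_pi.2 fun i => (l i).contDiff)

theorem contDiff_of_mem_cylindrical {E : Type*} [NormedAddCommGroup E] [NormedSpace ℝ E]
    {F : X → E} (hF : F ∈ cylindrical X E) : ContDiff ℝ ∞ F := by
  induction hF using Submodule.span_induction with
  | mem F h =>
    obtain ⟨f, e, hf, rfl⟩ := h
    exact hf.contDiff.smul contDiff_const
  | zero => exact contDiff_const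
  | add F G _ _ hF hG => exact hF.add hG
  | smul c F _ hF => exact contDiff_const.smul hF

end Cylindrical

/-! ### The closure of an operator in `Lᵖ` and the associated Sobolev space -/

section Closure

variable {X E G : Type*} [MeasurableSpace X]
  [NormedAddCommGroup E] [NormedSpace ℝ E] [NormedAddCommGroup G] [NormedSpace ℝ G]
  {T : Submodule ℝ (X → E)}

/-- `(F, Φ)` belongs to the closure in `Lᵖ(m; E) × Lᵖ(m; G)` of the graph of the operator `D`
defined on the space `T` of test functions. When `D` is a gradient: `F` is a Sobolev function of
exponent `p` with respect to `m`, and `Φ` is its (generalized) gradient. -/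
def HasGrad (D : T →ₗ[ℝ] (X → G)) (m : Measure X) (p : ℝ≥0∞) (F : X → E) (Φ : X → G) : Prop :=
  MemLp F p m ∧ MemLp Φ p m ∧
  ∃ u : ℕ → T,
    (∀ n, MemLp (u n : X → E) p m ∧ MemLp (D (u n)) p m) ∧
    Tendsto (fun n => eLpNorm ((u n : X → E) - F) p m) atTop (𝓝 0) ∧
    Tendsto (fun n => eLpNorm (D (u n) - Φ) p m) atTop (𝓝 0)

/-- Membership in the domain of the closure of `D` in `Lᵖ(m)`. -/
def MemW (D : T →ₗ[ℝ] (X → G)) (m : Measure X) (p : ℝ≥0∞) (F : X → E) : Prop :=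
  ∃ Φ, HasGrad D m p F Φ

/-- Closability: the closure of the graph of `D` in `Lᵖ(m)` is again the graph of an operator. -/
def Closable (D : T →ₗ[ℝ] (X → G)) (m : Measure X) (p : ℝ≥0∞) : Prop :=
  ∀ F Φ Φ', HasGrad D m p F Φ → HasGrad D m p F Φ' → Φ =ᵐ[m] Φ'

/-- The graph norm `‖F‖_{Lᵖ(m)} + ‖Φ‖_{Lᵖ(m)}`. -/
def wNorm (m : Measure X) (p : ℝ≥0∞) (F : X → E) (Φ : X → G) : ℝ≥0∞ :=
  eLpNorm F p m + eLpNorm Φ p m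

/-- The domain of the closure of `D` in `Lᵖ(m)` embeds continuously, by the identity on functions,
in the domain of the closure of `D` in `Lᵃ(m')`; the two closures of `D` agree, and the map is
well defined and injective on equivalence classes. -/
def Embeds (D : T →ₗ[ℝ] (X → G)) (m : Measure X) (p : ℝ≥0∞) (m' : Measure X) (a : ℝ≥0∞) : Prop :=
  (∃ C : ℝ≥0, ∀ F Φ, HasGrad D m p F Φ → HasGrad D m' a F Φ ∧ wNorm m' a F Φ ≤ C * wNorm m p F Φ) ∧
  ∀ F F', MemW D m p F → MemW D m p F' → (F =ᵐ[m] F' ↔ F =ᵐ[m'] F')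

theorem HasGrad.congr {D : T →ₗ[ℝ] (X → G)} {m : Measure X} {p : ℝ≥0∞} {F F' : X → E}
    {Φ Φ' : X → G} (h : HasGrad D m p F Φ) (hF : F =ᵐ[m] F') (hΦ : Φ =ᵐ[m] Φ') :
    HasGrad D m p F' Φ' := by
  obtain ⟨h1, h2, u, hu, h3, h4⟩ := h
  refine ⟨h1.ae_eq hF, h2.ae_eq hΦ, u, hu, ?_, ?_⟩
  · refine h3.congr fun n => eLpNorm_congr_ae ?_
    exact (EventuallyEq.refl _ _).sub hF
  · refine h4.congr fun n => eLpNorm_congr_ae ?_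
    exact (EventuallyEq.refl _ _).sub hΦ

theorem HasGrad.zero (D : T →ₗ[ℝ] (X → G)) (m : Measure X) (p : ℝ≥0∞) :
    HasGrad D m p 0 0 := by
  refine ⟨MemLp.zero, MemLp.zero, fun _ => 0, fun n => ⟨?_, ?_⟩, ?_, ?_⟩ <;> simp

theorem HasGrad.add {D : T →ₗ[ℝ] (X → G)} {m : Measure X} {p : ℝ≥0∞} (hp : 1 ≤ p) {F F' : X → E}
    {Φ Φ' : X → G} (h : HasGrad D m p F Φ) (h' : HasGrad D m p F' Φ') :
    HasGrad D m p (F + F') (Φ + Φ') := by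
  obtain ⟨h1, h2, u, hu, h3, h4⟩ := h
  obtain ⟨h1', h2', u', hu', h3', h4'⟩ := h'
  refine ⟨h1.add h1', h2.add h2', fun n => u n + u' n, fun n => ⟨?_, ?_⟩, ?_, ?_⟩
  · simpa using (hu n).1.add (hu' n).1
  · simpa using (hu n).2.add (hu' n).2
  · refine tendsto_of_tendsto_of_tendsto_of_le_of_le tendsto_const_nhds
      (by simpa using h3.add h3') (fun _ => zero_le) fun n => ?_
    have e : (((u n + u' n : T) : X → E) - (F + F')) = ((u n : X → E) - F) + ((u' n : X → E) - F') := by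
      rw [Submodule.coe_add]; abel
    change eLpNorm (((u n + u' n : T) : X → E) - (F + F')) p m ≤ _
    rw [e]
    exact eLpNorm_add_le ((hu n).1.1.sub h1.1) ((hu' n).1.1.sub h1'.1) hp
  · refine tendsto_of_tendsto_of_tendsto_of_le_of_le tendsto_const_nhds
      (by simpa using h4.add h4') (fun _ => zero_le) fun n => ?_
    have e : (D (u n + u' n) - (Φ + Φ')) = (D (u n) - Φ) + (D (u' n) - Φ') := by
      rw [map_add]; abel
    change eLpNorm (D (u n + u' n) - (Φ + Φ')) p m ≤ _
    rw [e]
    exact eLpNorm_add_le ((hu n).2.1.sub h2.1) ((hu' n).2.1.sub h2'.1) hp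

theorem HasGrad.smul {D : T →ₗ[ℝ] (X → G)} {m : Measure X} {p : ℝ≥0∞} {F : X → E}
    {Φ : X → G} (c : ℝ) (h : HasGrad D m p F Φ) : HasGrad D m p (c • F) (c • Φ) := by
  obtain ⟨h1, h2, u, hu, h3, h4⟩ := h
  refine ⟨h1.const_smul c, h2.const_smul c, fun n => c • u n, fun n => ⟨?_, ?_⟩, ?_, ?_⟩
  · simpa using (hu n).1.const_smul c
  · simpa using (hu n).2.const_smul c
  · have e : ∀ n, eLpNorm (((c • u n : T) : X → E) - c • F) p m
        = ‖c‖ₑ * eLpNorm ((u n : X → E) - F) p m := fun n => by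
      rw [Submodule.coe_smul, ← smul_sub, eLpNorm_const_smul]
    simp only [e]
    simpa using ENNReal.Tendsto.const_mul h3 (Or.inr enorm_ne_top)
  · have e : ∀ n, eLpNorm (D (c • u n) - c • Φ) p m = ‖c‖ₑ * eLpNorm (D (u n) - Φ) p m := fun n => by
      rw [map_smul, ← smul_sub, eLpNorm_const_smul]
    simp only [e]
    simpa using ENNReal.Tendsto.const_mul h4 (Or.inr enorm_ne_top)

/-- The Sobolev space as a normed space: the domain of the closure of `D` in `Lᵖ(m)`, each element
`F` being recorded as the pair `(F, D F)`, with the graph norm `‖F‖_{Lᵖ} + ‖D F‖_{Lᵖ}` (this is the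
norm of `WithLp 1` of a product). -/
def Sobolev (D : T →ₗ[ℝ] (X → G)) (m : Measure X) (p : ℝ≥0∞) [Fact (1 ≤ p)] :
    Submodule ℝ (WithLp 1 (Lp E p m × Lp G p m)) where
  carrier := {z | HasGrad D m p z.fst z.snd}
  zero_mem' := (HasGrad.zero D m p).congr (Lp.coeFn_zero E p m).symm (Lp.coeFn_zero G p m).symm
  add_mem' {a b} ha hb := (HasGrad.add Fact.out ha hb).congr
    (Lp.coeFn_add a.fst b.fst).symm (Lp.coeFn_add a.snd b.snd).symm
  smul_mem' c a ha := (HasGrad.smul c ha).congr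
    (Lp.coeFn_smul c a.fst).symm (Lp.coeFn_smul c a.snd).symm

/-- The normed space underlying `Sobolev D m p`. -/
def SobolevSpace (D : T →ₗ[ℝ] (X → G)) (m : Measure X) (p : ℝ≥0∞) [Fact (1 ≤ p)] : Type _ :=
  Sobolev D m p

instance (D : T →ₗ[ℝ] (X → G)) (m : Measure X) (p : ℝ≥0∞) [Fact (1 ≤ p)] :
    NormedAddCommGroup (SobolevSpace D m p) :=
  inferInstanceAs (NormedAddCommGroup (Sobolev D m p))

instance (D : T →ₗ[ℝ] (X → G)) (m : Measure X) (p : ℝ≥0∞) [Fact (1 ≤ p)] :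
    NormedSpace ℝ (SobolevSpace D m p) :=
  inferInstanceAs (NormedSpace ℝ (Sobolev D m p))

/-- A normed space is reflexive if its canonical embedding in its bidual is onto. -/
def IsReflexive (V : Type*) [NormedAddCommGroup V] [NormedSpace ℝ V] : Prop :=
  Function.Surjective (NormedSpace.inclusionInDoubleDual ℝ V)

end Closure

/-! ### The Cameron–Martin space and the gradient along it -/

section CameronMartin

variable {X : Type*} [NormedAddCommGroup X] [NormedSpace ℝ X]
  [MeasurableSpace X] [BorelSpace X]

/-- The closure `X*_μ` of `X*` in `L²(X, μ)`. -/
def dualClosure (μ : Measure X) : Submodule ℝ (Lp ℝ 2 μ) :=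
  (LinearMap.range
    (StrongDual.toLp (𝕜 := ℝ) μ 2 : StrongDual ℝ X →ₗ[ℝ] Lp ℝ 2 μ)).topologicalClosure

/-- The Cameron–Martin space `H = R_μ(X*_μ)` of a centered Gaussian measure, with the inner product
which makes `R_μ : X*_μ → H` a unitary map. The element `h ∈ H` is represented by
`ĥ = R_μ⁻¹ h ∈ X*_μ ⊆ L²(X, μ)`; as a vector of `X` it is `incl μ ĥ`. -/
def CM (μ : Measure X) : Type _ := dualClosure μ

instance (μ : Measure X) : NormedAddCommGroup (CM μ) :=
  inferInstanceAs (NormedAddCommGroup (dualClosure μ))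

instance (μ : Measure X) : InnerProductSpace ℝ (CM μ) :=
  inferInstanceAs (InnerProductSpace ℝ (dualClosure μ))

instance (μ : Measure X) : CompleteSpace (CM μ) :=
  (Submodule.isClosed_topologicalClosure _).completeSpace_coe

/-- The element `ĥ` of `L²(X, μ)` which represents `h ∈ H`. -/
def hat (μ : Measure X) : CM μ →ₗᵢ[ℝ] Lp ℝ 2 μ := (dualClosure μ).subtypeₗᵢ

variable [CompleteSpace X] [SecondCountableTopology X] (μ : Measure X) [IsGaussian μ]

theorem integrable_smul_id (g : Lp ℝ 2 μ) : Integrable (fun x => g x • x) μ := by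
  have h := (IsGaussian.memLp_two_id (μ := μ)).smul (Lp.memLp g) (r := 1)
  exact memLp_one_iff_integrable.1 h

/-- The map `R_μ`, `R_μ g = ∫ g(x) x dμ(x)`: it is the inclusion of the Cameron–Martin space
in `X`. -/
def incl : CM μ →L[ℝ] X :=
  LinearMap.mkContinuous
    { toFun := fun g => ∫ x, hat μ g x • x ∂μ
      map_add' := fun g h => by
        rw [← integral_add (integrable_smul_id μ _) (integrable_smul_id μ _)]
        refine integral_congr_ae ?_
        filter_upwards [Lp.coeFn_add (hat μ g) (hat μ h)] with x hx
        rw [map_add, hx, Pi.add_apply, add_smul]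
      map_smul' := fun c g => by
        rw [RingHom.id_apply, ← integral_smul]
        refine integral_congr_ae ?_
        filter_upwards [Lp.coeFn_smul c (hat μ g)] with x hx
        rw [map_smul, hx, Pi.smul_apply, smul_assoc] }
    (eLpNorm id 2 μ).toReal
    (fun g => by
      have hm : MemLp id 2 μ := IsGaussian.memLp_two_id
      have h1 : eLpNorm (fun x => hat μ g x • x) 1 μ
          ≤ eLpNorm (hat μ g) 2 μ * eLpNorm id 2 μ :=
        eLpNorm_smul_le_mul_eLpNorm hm.1 (Lp.memLp (hat μ g)).1
      change ‖∫ x, hat μ g x • x ∂μ‖ ≤ _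
      refine (norm_integral_le_lintegral_norm _).trans ?_
      rw [mul_comm, ← (hat μ).norm_map, Lp.norm_def, ← ENNReal.toReal_mul]
      refine ENNReal.toReal_mono
        (ENNReal.mul_ne_top (Lp.memLp (hat μ g)).2.ne hm.2.ne) ?_
      refine le_trans (le_of_eq ?_) h1
      rw [eLpNorm_one_eq_lintegral_enorm]
      simp only [ofReal_norm])

/-- For `f` differentiable at `x`, the gradient of `f` along `H` at `x`: the element `v` of `H`
such that `⟪v, h⟫_H` is the derivative of `f` at `x` in the direction `h`, for all `h ∈ H`. -/
def gradH (f : X → ℝ) (x : X) : CM μ :=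
  (InnerProductSpace.toDual ℝ (CM μ)).symm ((fderiv ℝ f x).comp (incl μ))

/-- The element `R_μ l` of `H`, for `l ∈ X*`. -/
def toH (l : StrongDual ℝ X) : CM μ :=
  ⟨StrongDual.toLp μ 2 l, Submodule.le_topologicalClosure _ ⟨l, rfl⟩⟩

theorem integral_mul_dual (g : CM μ) (l : StrongDual ℝ X) :
    ∫ x, hat μ g x * l x ∂μ = l (incl μ g) := by
  have h := l.integral_comp_comm (integrable_smul_id μ (hat μ g))
  simp only [map_smul, smul_eq_mul] at h
  exact h

theorem inner_toH (l : StrongDual ℝ X) (g : CM μ) : inner ℝ (toH μ l) g = l (incl μ g) := by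
  rw [← integral_mul_dual, ← (hat μ).inner_map_map, L2.inner_def]
  refine integral_congr_ae ?_
  have h2 : StrongDual.toLp μ 2 l =ᵐ[μ] l := by
    rw [StrongDual.toLp_apply IsGaussian.memLp_two_id]
    exact MemLp.coeFn_toLp _
  filter_upwards [h2] with x hx
  change inner ℝ ((StrongDual.toLp μ 2 l : Lp ℝ 2 μ) x) _ = _
  rw [hx]
  simp

theorem gradH_eq (f : X → ℝ) (x : X) : gradH μ f x = toH μ (fderiv ℝ f x) := by
  refine ext_inner_right ℝ fun g => ?_
  rw [inner_toH, gradH, InnerProductSpace.toDual_symm_apply]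
  rfl

/-- `R_μ` on `X*`, as a continuous linear map with values in `H`. -/
def toHL : StrongDual ℝ X →L[ℝ] CM μ :=
  (StrongDual.toLp μ 2).codRestrict _ fun l => Submodule.le_topologicalClosure _ ⟨l, rfl⟩

theorem differentiable_gradH {f : X → ℝ} (hf : ContDiff ℝ ∞ f) :
    Differentiable ℝ (gradH μ f) := by
  have h : gradH μ f = fun x => toHL μ (fderiv ℝ f x) := funext fun x => gradH_eq μ f x
  rw [h]
  exact (toHL μ).differentiable.comp
    ((hf.fderiv_right (m := 1) (by norm_cast)).differentiable (by norm_num))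

/-- The gradient along `H` of the real smooth cylindrical functions. -/
def gradOp : cylindrical X ℝ →ₗ[ℝ] (X → CM μ) where
  toFun u := gradH μ u
  map_add' u v := by
    funext x
    have hu := ((contDiff_of_mem_cylindrical u.2).differentiable (by simp)) x
    have hv := ((contDiff_of_mem_cylindrical v.2).differentiable (by simp)) x
    simp only [Pi.add_apply, gradH]
    rw [Submodule.coe_add, fderiv_add hu hv, ContinuousLinearMap.add_comp, map_add]
  map_smul' c u := by
    funext x
    have hu := ((contDiff_of_mem_cylindrical u.2).differentiable (by simp)) x
    simp only [Pi.smul_apply, gradH, RingHom.id_apply]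
    rw [Submodule.coe_smul, fderiv_const_smul hu, ContinuousLinearMap.smul_comp, map_smulₛₗ]
    simp

end CameronMartin

/-! ### Hilbert–Schmidt operators and the gradient of `H`-valued functions -/

section HilbertSchmidt

variable {X : Type*} [NormedAddCommGroup X] [NormedSpace ℝ X]
  [MeasurableSpace X] [BorelSpace X] [CompleteSpace X] [SecondCountableTopology X]
  (μ : Measure X) [IsGaussian μ] {ι : Type*} (e : HilbertBasis ι ℝ (CM μ))
  {E : Type*} [NormedAddCommGroup E] [InnerProductSpace ℝ E]

theorem sum_norm_sq_le (A : X →L[ℝ] E) (s : Finset ι) :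
    ∑ i ∈ s, ‖A (incl μ (e i))‖ ^ 2 ≤ ∫ y, ‖A y‖ ^ 2 ∂μ := by
  set c : ι → E := fun i => A (incl μ (e i)) with hc
  set g : ι → X → ℝ := fun i => hat μ (e i) with hg
  have hgm : ∀ i, MemLp (g i) 2 μ := fun i => Lp.memLp (hat μ (e i))
  have hA : MemLp (fun y => A y) 2 μ :=
    (IsGaussian.memLp_two_id (μ := μ)).continuousLinearMap_comp A
  have hAc : ∀ i, MemLp (fun y => inner ℝ (c i) (A y)) 2 μ := fun i => hA.const_inner (c i)
  have hgA : ∀ i, Integrable (fun y => g i y * inner ℝ (c i) (A y)) μ := fun i =>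
    (hgm i).integrable_mul (hAc i)
  have hgg : ∀ i j, Integrable (fun y => g i y * g j y) μ := fun i j =>
    (hgm i).integrable_mul (hgm j)
  have h1 : ∀ i, ∫ y, g i y * inner ℝ (c i) (A y) ∂μ = ‖c i‖ ^ 2 := fun i => by
    have h := integral_mul_dual μ (e i) ((innerSL ℝ (c i)).comp A)
    simp only [ContinuousLinearMap.comp_apply, innerSL_apply_apply] at h
    rw [h, real_inner_self_eq_norm_sq]
  have h2 : ∀ i j, ∫ y, g i y * g j y ∂μ = inner ℝ (e i) (e j) := fun i j => by
    rw [← (hat μ).inner_map_map, L2.inner_def]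
    refine integral_congr_ae (Eventually.of_forall fun y => ?_)
    simp [hg, mul_comm]
  have h3 : ∀ y, ‖A y - ∑ i ∈ s, g i y • c i‖ ^ 2 = ‖A y‖ ^ 2
      - 2 * ∑ i ∈ s, g i y * inner ℝ (c i) (A y)
      + ∑ i ∈ s, ∑ j ∈ s, (g i y * g j y) * inner ℝ (c i) (c j) := fun y => by
    rw [norm_sub_sq_real, ← real_inner_self_eq_norm_sq (∑ i ∈ s, g i y • c i), inner_sum]
    congr 2
    · congr 1
      refine Finset.sum_congr rfl fun i _ => ?_
      rw [inner_smul_right, real_inner_comm]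
    · rw [sum_inner]
      refine Finset.sum_congr rfl fun i _ => ?_
      rw [inner_sum]
      refine Finset.sum_congr rfl fun j _ => ?_
      rw [inner_smul_left, inner_smul_right]
      simp [mul_assoc]
  have h4 : ∫ y, ‖A y - ∑ i ∈ s, g i y • c i‖ ^ 2 ∂μ
      = ∫ y, ‖A y‖ ^ 2 ∂μ - 2 * ∑ i ∈ s, ‖c i‖ ^ 2 + ∑ i ∈ s, ‖c i‖ ^ 2 := by
    simp only [h3]
    have i1 : Integrable (fun y => ‖A y‖ ^ 2) μ := hA.integrable_norm_pow (by norm_num)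
    have i2 : Integrable (fun y => 2 * ∑ i ∈ s, g i y * inner ℝ (c i) (A y)) μ :=
      (integrable_finsetSum _ fun i _ => hgA i).const_mul 2
    have i3 : Integrable
        (fun y => ∑ i ∈ s, ∑ j ∈ s, (g i y * g j y) * inner ℝ (c i) (c j)) μ :=
      integrable_finsetSum _ fun i _ => integrable_finsetSum _ fun j _ => (hgg i j).mul_const _
    have i4 : Integrable (fun y => ‖A y‖ ^ 2 - 2 * ∑ i ∈ s, g i y * inner ℝ (c i) (A y)) μ :=
      i1.sub i2
    rw [integral_add i4 i3, integral_sub i1 i2, integral_const_mul,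
      integral_finsetSum _ fun i _ => hgA i,
      integral_finsetSum _ fun i _ => integrable_finsetSum _ fun j _ => (hgg i j).mul_const _]
    simp only [h1]
    congr 1
    refine Finset.sum_congr rfl fun i hi => ?_
    rw [integral_finsetSum _ fun j _ => (hgg i j).mul_const _]
    simp only [integral_mul_const, h2]
    classical
    have ho := orthonormal_iff_ite.1 e.orthonormal
    simp only [ho, ite_mul, one_mul, zero_mul, Finset.sum_ite_eq, hi, if_true]
    exact real_inner_self_eq_norm_sq _
  have h5 : 0 ≤ ∫ y, ‖A y - ∑ i ∈ s, g i y • c i‖ ^ 2 ∂μ := integral_nonneg fun y => by positivity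
  change ∑ i ∈ s, ‖c i‖ ^ 2 ≤ _
  linarith

/-- A Hilbert–Schmidt operator `B : H → E` is represented by the square summable family `(B eᵢ)ᵢ`,
where `(eᵢ)ᵢ` is an orthonormal basis of `H`; this is an isometry of the space of Hilbert–Schmidt
operators, with the norm `‖B‖² = ∑ᵢ ‖B eᵢ‖²`, onto `ℓ²(ι; E)`. -/
abbrev HS (_e : HilbertBasis ι ℝ (CM μ)) (E : Type*) [NormedAddCommGroup E] : Type _ :=
  lp (fun _ : ι => E) 2

/-- The restriction to `H` of a bounded operator `A : X → E`, as a Hilbert–Schmidt operator. -/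
def restrictHS : (X →L[ℝ] E) →ₗ[ℝ] HS μ e E where
  toFun A := ⟨fun i => A (incl μ (e i)), memℓp_gen' (C := ∫ y, ‖A y‖ ^ 2 ∂μ) fun s => by
    simpa using sum_norm_sq_le μ e A s⟩
  map_add' _ _ := rfl
  map_smul' _ _ := rfl

/-- The gradient along `H` of the `E`-valued smooth cylindrical functions: at `x` it is the
Hilbert–Schmidt operator `h ↦ ∂_h F(x)` from `H` to `E`. -/
def gradOpV (E : Type*) [NormedAddCommGroup E] [InnerProductSpace ℝ E] :
    cylindrical X E →ₗ[ℝ] (X → HS μ e E) where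
  toFun u x := restrictHS μ e (fderiv ℝ (u : X → E) x)
  map_add' u v := by
    funext x
    have hu := ((contDiff_of_mem_cylindrical u.2).differentiable (by simp)) x
    have hv := ((contDiff_of_mem_cylindrical v.2).differentiable (by simp)) x
    simp only [Pi.add_apply]
    rw [Submodule.coe_add, fderiv_add hu hv, map_add]
  map_smul' c u := by
    funext x
    have hu := ((contDiff_of_mem_cylindrical u.2).differentiable (by simp)) x
    simp only [Pi.smul_apply, RingHom.id_apply]
    rw [Submodule.coe_smul, fderiv_const_smul hu, map_smul]

/-- The operator `f ↦ (∇_H f, ∇_H² f)` on the real smooth cylindrical functions, where `∇_H² f(x)`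
is the Hilbert–Schmidt operator `h ↦ ∂_h (∇_H f)(x)` on `H`. The domain of its closure in `Lᵖ(μ)`
is `W^{2,p}(X, μ)`. -/
def hessOp : cylindrical X ℝ →ₗ[ℝ] (X → CM μ × HS μ e (CM μ)) where
  toFun u x := (gradOp μ u x, restrictHS μ e (fderiv ℝ (gradOp μ u) x))
  map_add' u v := by
    funext x
    have hu := differentiable_gradH μ (contDiff_of_mem_cylindrical u.2) x
    have hv := differentiable_gradH μ (contDiff_of_mem_cylindrical v.2) x
    have h : fderiv ℝ (gradOp μ u + gradOp μ v) x
        = fderiv ℝ (gradOp μ u) x + fderiv ℝ (gradOp μ v) x := fderiv_add hu hv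
    rw [map_add, h, map_add]
    rfl
  map_smul' c u := by
    funext x
    have hu := differentiable_gradH μ (contDiff_of_mem_cylindrical u.2) x
    have h : fderiv ℝ (c • gradOp μ u) x = c • fderiv ℝ (gradOp μ u) x :=
      fderiv_const_smul hu c
    rw [map_smul, h, map_smul]
    rfl

end HilbertSchmidt

/-- The weighted measure `w μ`. -/
def weighted {X : Type*} [MeasurableSpace X] (μ : Measure X) (w : X → ℝ) : Measure X :=
  μ.withDensity fun x => ENNReal.ofReal (w x)

end WGauss

end

set_option linter.unusedSectionVars false

/-! The measures μ and ν are mutually absolutely continuous, and a generalized gradient is a limit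
of gradients of cylindrical functions, the same ones for every measure and exponent. An inclusion
L^p(m) ⊆ L^a(m') therefore carries Sobolev functions to Sobolev functions with the same gradient
(`HasGrad.transfer`, `LpLe.embeds`), and the embeddings reduce to Hölder: ∫ |g|^p w dμ is controlled
by w in L^s and |g|^p in L^{s'}; conversely |g|^{pr} = (w|g|^p)^r w^{-r} is treated with the
exponents 1/r and 1/(1-r).

Closability rests on the integration by parts ∫ ⟨∇_H f, R_μ l⟩ dν = ∫ f β_l dν with β_l = l - ⟨∇_H
log w, R_μ l⟩, for l in X*. For μ itself this is Stein's identity in the direction R_μ l, because μ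
splits into a one-dimensional Gaussian along that direction and an independent complement. It passes
to ν by testing with f θ_k(log w), where θ_k are truncations of exp
(`integral_inner_gradH_weighted`). Now β_l is in L^t(μ), and L^t(μ) ⊆ L^{p'}(ν) when p's' ≤ t, which
is exactly p ≥ t/(t-s'). So each component of a gradient has prescribed integrals against
cylindrical functions, and these separate L^1(ν) because characteristic functionals determine finite
measures.

Reflexivity and stability under bounded pointwise limits come from one compactness principle. The
gauge ‖F‖^p + ‖DF‖^p is uniformly convex on bounded sets, as p > 1 and the values lie in Hilbert
spaces; in a complete space with such a gauge, a directed family of nonempty bounded closed convex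
sets has a common point (`IsUniformlyConvexGauge.exists_forall_mem`). Together with Helly's lemma
this is Milman–Pettis; applied to closed convex hulls of the tails of a sequence it identifies the
pointwise limit. The product rule is the Leibniz rule for the approximants together with Hölder. -/

namespace WGauss

/-! ### The algebra of smooth cylindrical functions -/

section BddSmooth

variable {V W : Type*} [NormedAddCommGroup V] [NormedSpace ℝ V]
  [NormedAddCommGroup W] [NormedSpace ℝ W]

/-- Smooth functions which are bounded together with all their derivatives. -/
def BddSmooth (φ : V → ℝ) : Prop :=
  ContDiff ℝ ∞ φ ∧ ∀ k : ℕ, ∃ C : ℝ, ∀ y, ‖iteratedFDeriv ℝ k φ y‖ ≤ C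

theorem BddSmooth.add {φ ψ : V → ℝ} (hφ : BddSmooth φ) (hψ : BddSmooth ψ) :
    BddSmooth (fun y => φ y + ψ y) := by
  refine ⟨hφ.1.add hψ.1, fun k => ?_⟩
  obtain ⟨A, hA⟩ := hφ.2 k
  obtain ⟨B, hB⟩ := hψ.2 k
  refine ⟨A + B, fun y => ?_⟩
  have h := iteratedFDeriv_add_apply (𝕜 := ℝ) (i := k) (x := y)
    ((hφ.1.of_le (mod_cast le_top)).contDiffAt) ((hψ.1.of_le (mod_cast le_top)).contDiffAt)
  change ‖iteratedFDeriv ℝ k (φ + ψ) y‖ ≤ _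
  rw [h]
  exact (norm_add_le _ _).trans (add_le_add (hA y) (hB y))

theorem BddSmooth.const_mul {φ : V → ℝ} (c : ℝ) (hφ : BddSmooth φ) :
    BddSmooth (fun y => c * φ y) := by
  refine ⟨contDiff_const.mul hφ.1, fun k => ?_⟩
  obtain ⟨A, hA⟩ := hφ.2 k
  refine ⟨‖c‖ * A, fun y => ?_⟩
  have h := iteratedFDeriv_const_smul_apply (𝕜 := ℝ) (i := k) (x := y) (a := c)
    ((hφ.1.of_le (mod_cast le_top)).contDiffAt)
  change ‖iteratedFDeriv ℝ k (c • φ) y‖ ≤ _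
  rw [h, norm_smul]
  exact mul_le_mul_of_nonneg_left (hA y) (norm_nonneg _)

theorem BddSmooth.mul {φ ψ : V → ℝ} (hφ : BddSmooth φ) (hψ : BddSmooth ψ) :
    BddSmooth (fun y => φ y * ψ y) := by
  refine ⟨hφ.1.mul hψ.1, fun k => ?_⟩
  choose A hA using hφ.2
  choose B hB using hψ.2
  refine ⟨∑ i ∈ Finset.range (k + 1), (k.choose i : ℝ) * A i * B (k - i), fun y => ?_⟩
  refine (norm_iteratedFDeriv_mul_le hφ.1 hψ.1 y (mod_cast le_top)).trans ?_
  refine Finset.sum_le_sum fun i _ => ?_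
  have hAi : 0 ≤ A i := (norm_nonneg _).trans (hA i y)
  gcongr
  · exact hA i y
  · exact hB (k - i) y

theorem BddSmooth.comp_clm {φ : W → ℝ} (hφ : BddSmooth φ) (L : V →L[ℝ] W) :
    BddSmooth (fun y => φ (L y)) := by
  refine ⟨hφ.1.comp L.contDiff, fun k => ?_⟩
  obtain ⟨A, hA⟩ := hφ.2 k
  refine ⟨A * ‖L‖ ^ k, fun y => ?_⟩
  change ‖iteratedFDeriv ℝ k (φ ∘ L) y‖ ≤ _
  rw [L.iteratedFDeriv_comp_right hφ.1 y (mod_cast le_top)]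
  refine (ContinuousMultilinearMap.norm_compContinuousLinearMap_le _ _).trans ?_
  simp only [Finset.prod_const, Finset.card_univ, Fintype.card_fin]
  gcongr
  exact hA _

theorem BddSmooth.comp {θ : ℝ → ℝ} (hθ : BddSmooth θ) {φ : V → ℝ} (hφ : BddSmooth φ) :
    BddSmooth (fun y => θ (φ y)) := by
  refine ⟨hθ.1.comp hφ.1, fun k => ?_⟩
  choose A hA using hθ.2
  choose B hB using hφ.2
  set C : ℝ := ∑ i ∈ Finset.range (k + 1), |A i| with hC
  -- The summand 1 makes D ≥ 1, so that a bound by D is also a bound by D ^ i for i ≥ 1, the form in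
  -- which the Faà di Bruno estimate wants it.
  set D : ℝ := 1 + ∑ i ∈ Finset.range (k + 1), |B i| with hD
  have hD1 : 1 ≤ D := le_add_of_nonneg_right (Finset.sum_nonneg fun i _ => abs_nonneg _)
  refine ⟨k.factorial * C * D ^ k, fun y => ?_⟩
  refine norm_iteratedFDeriv_comp_le hθ.1 hφ.1 (mod_cast le_top) y (fun i hi => ?_)
    (fun i h1 hi => ?_)
  · refine (hA i _).trans ((le_abs_self _).trans ?_)
    exact Finset.single_le_sum (f := fun i => |A i|) (fun j _ => abs_nonneg _)
      (Finset.mem_range.2 (by omega))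
  · refine (hB i _).trans ((le_abs_self _).trans ?_)
    have h : |B i| ≤ D := (Finset.single_le_sum (f := fun i => |B i|) (fun j _ => abs_nonneg _)
      (Finset.mem_range.2 (by omega))).trans (le_add_of_nonneg_left zero_le_one)
    exact h.trans (le_self_pow₀ hD1 (by omega))

theorem bddSmooth_const (c : ℝ) : BddSmooth (fun _ : V => c) := by
  refine ⟨contDiff_const, fun k => ⟨|c|, fun y => ?_⟩⟩
  rcases k with _ | k
  · simp
  · rw [iteratedFDeriv_const_of_ne (by omega)]
    simp

theorem bddSmooth_of_hasCompactSupport {φ : V → ℝ} (h : ContDiff ℝ ∞ φ)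
    (hc : HasCompactSupport φ) : BddSmooth φ := by
  refine ⟨h, fun k => ?_⟩
  exact (h.continuous_iteratedFDeriv (m := k) (mod_cast le_top)).bounded_above_of_compact_support
    (hc.iteratedFDeriv k)

/-- Cosine and sine of a functional are the real and imaginary parts of a character, hence the test
functions that reach the characteristic functional of a measure. -/
theorem bddSmooth_cos : BddSmooth Real.cos := by
  refine ⟨Real.contDiff_cos, fun k => ⟨1, fun y => ?_⟩⟩
  rw [norm_iteratedFDeriv_eq_norm_iteratedDeriv]
  exact Real.abs_iteratedDeriv_cos_le_one k y

theorem bddSmooth_sin : BddSmooth Real.sin := by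
  refine ⟨Real.contDiff_sin, fun k => ⟨1, fun y => ?_⟩⟩
  rw [norm_iteratedFDeriv_eq_norm_iteratedDeriv]
  exact Real.abs_iteratedDeriv_sin_le_one k y

theorem BddSmooth.exists_bound {φ : V → ℝ} (h : BddSmooth φ) : ∃ C, ∀ y, |φ y| ≤ C := by
  obtain ⟨C, hC⟩ := h.2 0
  exact ⟨C, fun y => by simpa using hC y⟩

theorem BddSmooth.exists_fderiv_bound {φ : V → ℝ} (h : BddSmooth φ) :
    ∃ C, ∀ y, ‖fderiv ℝ φ y‖ ≤ C := by
  obtain ⟨C, hC⟩ := h.2 1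
  exact ⟨C, fun y => by simpa [norm_iteratedFDeriv_one] using hC y⟩

end BddSmooth

section Cylindrical

variable {X : Type*} [NormedAddCommGroup X] [NormedSpace ℝ X]

theorem IsSmoothCylindrical.bddSmooth {f : X → ℝ} (hf : IsSmoothCylindrical f) :
    BddSmooth f := by
  obtain ⟨n, φ, l, hφ, hb, rfl⟩ := hf
  exact BddSmooth.comp_clm (φ := φ) ⟨hφ, hb⟩ (ContinuousLinearMap.pi l)

theorem isSmoothCylindrical_of_bddSmooth {n : ℕ} {φ : (Fin n → ℝ) → ℝ} (hφ : BddSmooth φ)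
    (l : Fin n → StrongDual ℝ X) : IsSmoothCylindrical fun x => φ fun i => l i x :=
  ⟨n, φ, l, hφ.1, hφ.2, rfl⟩

/-- Two smooth cylindrical functions can be written with the same functionals. -/
theorem IsSmoothCylindrical.exists_common {f g : X → ℝ} (hf : IsSmoothCylindrical f)
    (hg : IsSmoothCylindrical g) :
    ∃ (n : ℕ) (φ ψ : (Fin n → ℝ) → ℝ) (l : Fin n → StrongDual ℝ X), BddSmooth φ ∧ BddSmooth ψ ∧
      (f = fun x => φ fun i => l i x) ∧ g = fun x => ψ fun i => l i x := by
  obtain ⟨n, φ, l, hφ, hb, rfl⟩ := hf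
  obtain ⟨m, ψ, k, hψ, hb', rfl⟩ := hg
  refine ⟨n + m, fun y => φ fun i => y (Fin.castAdd m i), fun y => ψ fun i => y (Fin.natAdd n i),
    Fin.append l k, ?_, ?_, ?_, ?_⟩
  · exact BddSmooth.comp_clm (φ := φ) ⟨hφ, hb⟩
      (ContinuousLinearMap.pi fun i => ContinuousLinearMap.proj (R := ℝ)
        (φ := fun _ : Fin (n + m) => ℝ) (Fin.castAdd m i))
  · exact BddSmooth.comp_clm (φ := ψ) ⟨hψ, hb'⟩
      (ContinuousLinearMap.pi fun i => ContinuousLinearMap.proj (R := ℝ)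
        (φ := fun _ : Fin (n + m) => ℝ) (Fin.natAdd n i))
  · simp
  · simp

theorem IsSmoothCylindrical.add {f g : X → ℝ} (hf : IsSmoothCylindrical f)
    (hg : IsSmoothCylindrical g) : IsSmoothCylindrical (fun x => f x + g x) := by
  obtain ⟨n, φ, ψ, l, hφ, hψ, rfl, rfl⟩ := hf.exists_common hg
  exact isSmoothCylindrical_of_bddSmooth (hφ.add hψ) l

theorem IsSmoothCylindrical.mul {f g : X → ℝ} (hf : IsSmoothCylindrical f)
    (hg : IsSmoothCylindrical g) : IsSmoothCylindrical (fun x => f x * g x) := by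
  obtain ⟨n, φ, ψ, l, hφ, hψ, rfl, rfl⟩ := hf.exists_common hg
  exact isSmoothCylindrical_of_bddSmooth (hφ.mul hψ) l

theorem IsSmoothCylindrical.const_mul {f : X → ℝ} (c : ℝ) (hf : IsSmoothCylindrical f) :
    IsSmoothCylindrical (fun x => c * f x) := by
  obtain ⟨n, φ, l, hφ, hb, rfl⟩ := hf
  exact isSmoothCylindrical_of_bddSmooth (BddSmooth.const_mul c ⟨hφ, hb⟩) l

theorem IsSmoothCylindrical.comp {f : X → ℝ} {θ : ℝ → ℝ} (hθ : BddSmooth θ)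
    (hf : IsSmoothCylindrical f) : IsSmoothCylindrical (fun x => θ (f x)) := by
  obtain ⟨n, φ, l, hφ, hb, rfl⟩ := hf
  exact isSmoothCylindrical_of_bddSmooth (hθ.comp (φ := φ) ⟨hφ, hb⟩) l

theorem isSmoothCylindrical_comp_dual {θ : ℝ → ℝ} (hθ : BddSmooth θ) (l : StrongDual ℝ X) :
    IsSmoothCylindrical fun x => θ (l x) :=
  isSmoothCylindrical_of_bddSmooth (n := 1) (φ := fun y => θ (y 0))
    (hθ.comp_clm (ContinuousLinearMap.proj (R := ℝ) (φ := fun _ : Fin 1 => ℝ) 0)) fun _ => l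

theorem IsSmoothCylindrical.mem_cylindrical {f : X → ℝ} (hf : IsSmoothCylindrical f) :
    f ∈ cylindrical X ℝ :=
  Submodule.subset_span ⟨f, 1, hf, by simp⟩

/-- For real values the span adds nothing, because the generators are already stable under sums and
multiples; a test function can thus be multiplied or composed like a single φ(l₁, …, lₙ). -/
theorem isSmoothCylindrical_of_mem {f : X → ℝ} (hf : f ∈ cylindrical X ℝ) :
    IsSmoothCylindrical f := by
  induction hf using Submodule.span_induction with
  | mem F h =>
    obtain ⟨f, c, hf, rfl⟩ := h
    simpa [mul_comm] using hf.const_mul c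
  | zero => exact isSmoothCylindrical_of_bddSmooth (bddSmooth_const 0) (Fin.elim0 (α := _))
  | add F G _ _ hF hG => exact hF.add hG
  | smul c F _ hF => exact hF.const_mul c

variable {E E' : Type*} [NormedAddCommGroup E] [NormedSpace ℝ E]
  [NormedAddCommGroup E'] [NormedSpace ℝ E']

/-- Taking for `T` the inner product with a fixed vector reduces vector-valued test functions to
real ones. -/
theorem comp_mem_cylindrical (T : E →L[ℝ] E') {F : X → E} (hF : F ∈ cylindrical X E) :
    (fun x => T (F x)) ∈ cylindrical X E' := by
  induction hF using Submodule.span_induction with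
  | mem F h =>
    obtain ⟨f, e, hf, rfl⟩ := h
    exact Submodule.subset_span ⟨f, T e, hf, by simp⟩
  | zero =>
    simp only [Pi.zero_apply, map_zero]
    exact (cylindrical X E').zero_mem
  | add F G _ _ hF hG =>
    simp only [Pi.add_apply, map_add]
    exact (cylindrical X E').add_mem hF hG
  | smul c F _ hF =>
    simp only [Pi.smul_apply, map_smul]
    exact (cylindrical X E').smul_mem c hF

end Cylindrical

end WGauss

namespace WGauss

/-! ### Integration by parts for a Gaussian measure -/

section OneDim

theorem integrable_gaussianPDFReal_mul {v : ℝ≥0} (hv : v ≠ 0) {f : ℝ → ℝ}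
    (hf : Integrable f (gaussianReal 0 v)) :
    Integrable fun x => gaussianPDFReal 0 v x * f x := by
  rw [gaussianReal_of_var_ne_zero _ hv, integrable_withDensity_iff_integrable_smul'
    (measurable_gaussianPDF _ _) (ae_of_all _ fun x => gaussianPDF_lt_top)] at hf
  simpa [toReal_gaussianPDF] using hf

theorem hasDerivAt_gaussianPDFReal (v : ℝ≥0) (x : ℝ) :
    HasDerivAt (gaussianPDFReal 0 v) (-(x / v) * gaussianPDFReal 0 v x) x := by
  unfold gaussianPDFReal
  have h1 : HasDerivAt (fun y : ℝ => -(y - 0) ^ 2 / (2 * (v : ℝ))) (-(x / v)) x := by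
    have h := (((hasDerivAt_id x).sub_const 0).pow 2).neg.div_const (2 * (v : ℝ))
    refine h.congr_deriv ?_
    simp
    ring
  refine (h1.exp.const_mul _).congr_deriv ?_
  ring

/-- Stein's identity. -/
theorem integral_deriv_gaussianReal {v : ℝ≥0} (hv : v ≠ 0) {g g' : ℝ → ℝ}
    (hg : ∀ x, HasDerivAt g (g' x) x) (hg'm : Continuous g') {C C' : ℝ} (hC : ∀ x, |g x| ≤ C)
    (hC' : ∀ x, |g' x| ≤ C') :
    (v : ℝ) * ∫ x, g' x ∂(gaussianReal 0 v) = ∫ x, g x * x ∂(gaussianReal 0 v) := by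
  have hgm : Continuous g := continuous_iff_continuousAt.2 fun x => (hg x).continuousAt
  have i1 : Integrable g' (gaussianReal 0 v) :=
    Integrable.of_bound hg'm.aestronglyMeasurable C' (ae_of_all _ hC')
  have i0 : Integrable g (gaussianReal 0 v) :=
    Integrable.of_bound hgm.aestronglyMeasurable C (ae_of_all _ hC)
  have i2 : Integrable (fun x => g x * x) (gaussianReal 0 v) :=
    (IsGaussian.integrable_id (μ := gaussianReal 0 v)).bdd_mul hgm.aestronglyMeasurable
      (ae_of_all _ hC)
  have j1 := integrable_gaussianPDFReal_mul hv i1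
  have j0 := integrable_gaussianPDFReal_mul hv i0
  have j2 := integrable_gaussianPDFReal_mul hv i2
  rw [integral_gaussianReal_eq_integral_smul hv, integral_gaussianReal_eq_integral_smul hv]
  -- The density ρ satisfies ρ' = -(x/v) ρ. There is no boundary term on ℝ, since ρ g and both terms
  -- of its derivative are integrable.
  have key := integral_mul_deriv_eq_deriv_mul_of_integrable
    (u := gaussianPDFReal 0 v) (v := g) (u' := fun x => -(x / v) * gaussianPDFReal 0 v x) (v' := g')
    (fun x _ => hasDerivAt_gaussianPDFReal v x) (fun x _ => hg x) j1 ?_ j0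
  · simp only [smul_eq_mul]
    rw [key, ← integral_neg, ← integral_const_mul]
    refine integral_congr_ae (ae_of_all _ fun x => ?_)
    have : (v : ℝ) ≠ 0 := by exact_mod_cast hv
    field_simp
  · refine (j2.const_mul (-(v : ℝ)⁻¹)).congr (ae_of_all _ fun x => ?_)
    simp only [Pi.mul_apply]
    ring

end OneDim

/-! ### Integration by parts along R_μ l on the Banach space -/

section Banach

theorem memLp_dual {X : Type*} [NormedAddCommGroup X] [NormedSpace ℝ X] [MeasurableSpace X]
    [BorelSpace X] (μ : Measure X) [IsGaussian μ] (l : StrongDual ℝ X) {p : ℝ≥0∞} (hp : p ≠ ⊤) :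
    MemLp l p μ :=
  IsGaussian.memLp_dual μ l p hp

variable {X : Type*} [NormedAddCommGroup X] [NormedSpace ℝ X] [CompleteSpace X]
  [SecondCountableTopology X] [MeasurableSpace X] [BorelSpace X]
  (μ : Measure X) [IsGaussian μ]

theorem integral_dual_mul_dual (l k : StrongDual ℝ X) :
    ∫ x, l x * k x ∂μ = k (incl μ (toH μ l)) := by
  rw [← integral_mul_dual]
  have h2 : StrongDual.toLp μ 2 l =ᵐ[μ] l := by
    rw [StrongDual.toLp_apply IsGaussian.memLp_two_id]
    exact MemLp.coeFn_toLp _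
  refine integral_congr_ae ?_
  filter_upwards [h2] with x hx
  change _ = (StrongDual.toLp μ 2 l : Lp ℝ 2 μ) x * _
  rw [hx]

/-- The covariance operator is R_μ restricted to X*: a functional k that vanishes on R_μ l is
uncorrelated with l. -/
theorem covariance_dual (hcentered : ∀ l : StrongDual ℝ X, ∫ x, l x ∂μ = 0)
    (l k : StrongDual ℝ X) :
    cov[l, k; μ] = k (incl μ (toH μ l)) := by
  rw [covariance_eq_sub (memLp_dual μ l (by simp)) (memLp_dual μ k (by simp)), hcentered l]
  simp only [zero_mul, sub_zero, Pi.mul_apply]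
  exact integral_dual_mul_dual μ l k

/-- Integration by parts along `R_μ l`, for `l ∈ X*`. -/
theorem integral_fderiv_incl_toH (hcentered : ∀ l : StrongDual ℝ X, ∫ x, l x ∂μ = 0)
    (l : StrongDual ℝ X) {f : X → ℝ} (hf : ContDiff ℝ 1 f)
    {C C' : ℝ} (hC : ∀ x, |f x| ≤ C) (hC' : ∀ x, ‖fderiv ℝ f x‖ ≤ C') :
    ∫ x, fderiv ℝ f x (incl μ (toH μ l)) ∂μ = ∫ x, f x * l x ∂μ := by
  set h : X := incl μ (toH μ l) with hh
  set c : ℝ := l h with hc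
  have hv : Var[l; μ] = c := by
    rw [← covariance_self (by fun_prop)]
    exact covariance_dual μ hcentered l l
  have hc0 : 0 ≤ c := hv ▸ variance_nonneg _ _
  -- If the variance of l is zero, then l = 0 almost everywhere and R_μ l = 0, so both sides vanish.
  rcases hc0.eq_or_lt with hc0 | hc0
  · have hl : l =ᵐ[μ] 0 := by
      have h1 : ∫ x, l x * l x ∂μ = 0 := (integral_dual_mul_dual μ l l).trans hc0.symm
      rw [integral_eq_zero_iff_of_nonneg (fun x => mul_self_nonneg _)
        ((memLp_dual μ l (p := 2) (by simp)).integrable_mul (memLp_dual μ l (p := 2) (by simp)))] at h1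
      filter_upwards [h1] with x hx
      simpa using hx
    have hh0 : h = 0 := by
      have h1 : inner ℝ (toH μ l) (toH μ l) = 0 := (inner_toH μ l _).trans hc0.symm
      rw [hh, inner_self_eq_zero.1 h1, map_zero]
    rw [hh0]
    simp only [map_zero, integral_zero]
    symm
    refine integral_eq_zero_of_ae ?_
    filter_upwards [hl] with x hx
    simp [hx]
  · have hcne : c ≠ 0 := hc0.ne'
    set v : ℝ≥0 := c.toNNReal with hvdef
    have hvc : (v : ℝ) = c := Real.coe_toNNReal c hc0.le
    have hvne : v ≠ 0 := by
      intro h0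
      rw [h0] at hvc
      exact hcne hvc.symm
    -- This projection kills h = R_μ l. Every L₂ ∘ π is then uncorrelated with l, since its
    -- covariance with l is L₂(π h) = 0; for the jointly Gaussian pair (l, π) this means
    -- independence. As x = π x + (l x / c) h, Fubini leaves a one-dimensional integral in s = l x
    -- for each fixed value of π.
    set π : X →L[ℝ] X := ContinuousLinearMap.id ℝ X - (c⁻¹ • l).smulRight h with hπ
    have hπx : ∀ x, π x = x - (c⁻¹ * l x) • h := fun x => by simp [hπ]
    have hgauss : HasGaussianLaw (fun x => (l x, π x)) μ :=
      IsGaussian.hasGaussianLaw_id.map_fun (l.prod π)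
    have hind : IndepFun l π μ := by
      refine hgauss.indepFun_of_covariance_strongDual fun L₁ L₂ => ?_
      have e := covariance_dual μ hcentered (L₁.comp l) (L₂.comp π)
      have e1 : toH μ (L₁.comp l) = L₁ 1 • toH μ l := by
        have : L₁.comp l = L₁ 1 • l := by
          ext x
          have := L₁.map_smul (l x) 1
          simp only [smul_eq_mul, mul_one] at this
          simp [this, mul_comm]
        rw [this]
        exact (toHL μ).map_smul _ _
      have e2 : π h = 0 := by
        rw [hπx, ← hc, inv_mul_cancel₀ hcne, one_smul, sub_self]
      rw [e1, map_smul, ← hh, map_smul, ContinuousLinearMap.comp_apply, e2, map_zero,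
        smul_zero] at e
      exact e
    have hlmap : μ.map l = gaussianReal 0 v := by
      rw [IsGaussian.map_eq_gaussianReal l, hcentered l, hv]
    have hprod : μ.map (fun x => (l x, π x)) = (gaussianReal 0 v).prod (μ.map π) := by
      rw [(indepFun_iff_map_prod_eq_prod_map_map (by fun_prop) (by fun_prop)).1 hind, hlmap]
    have : IsProbabilityMeasure (μ.map π) := Measure.isProbabilityMeasure_map (by fun_prop)
    have hrec : ∀ x, π x + (c⁻¹ * l x) • h = x := fun x => by rw [hπx, sub_add_cancel]
    have hfc : Continuous f := hf.continuous
    have hf'c : Continuous (fderiv ℝ f) := hf.continuous_fderiv (by simp)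
    have fub : ∀ F : ℝ × X → ℝ, Integrable F ((gaussianReal 0 v).prod (μ.map π)) →
        ∫ x, F (l x, π x) ∂μ = ∫ y, ∫ s, F (s, y) ∂(gaussianReal 0 v) ∂(μ.map π) := by
      intro F hF
      rw [← integral_prod_symm _ hF, ← hprod, integral_map (by fun_prop)]
      rw [hprod]
      exact hF.aestronglyMeasurable
    have hT : Continuous fun z : ℝ × X => z.2 + (c⁻¹ * z.1) • h := by fun_prop
    have hF1 := fub (fun z => fderiv ℝ f (z.2 + (c⁻¹ * z.1) • h) h) (by
      refine Integrable.of_bound (Continuous.aestronglyMeasurable ?_) (C' * ‖h‖)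
        (ae_of_all _ fun z => ?_)
      · exact (hf'c.comp hT).clm_apply continuous_const
      · exact (ContinuousLinearMap.le_opNorm _ _).trans
          (mul_le_mul_of_nonneg_right (hC' _) (norm_nonneg _)))
    have hF2 := fub (fun z => f (z.2 + (c⁻¹ * z.1) • h) * z.1) (by
      have i1 : Integrable (fun z : ℝ × X => z.1) ((gaussianReal 0 v).prod (μ.map π)) :=
        (IsGaussian.integrable_id (μ := gaussianReal 0 v)).comp_fst _
      exact i1.bdd_mul (hfc.comp hT).aestronglyMeasurable (ae_of_all _ fun z => hC _))
    simp only [hrec] at hF1 hF2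
    rw [hF1, hF2]
    refine integral_congr_ae (ae_of_all _ fun y => ?_)
    -- The chain rule produces the factor 1/c, which cancels the variance v = c in Stein's identity.
    have st := integral_deriv_gaussianReal hvne (g := fun s => f (y + (c⁻¹ * s) • h))
      (g' := fun s => c⁻¹ * fderiv ℝ f (y + (c⁻¹ * s) • h) h) (fun s => ?_) ?_ (C := C)
      (C' := |c⁻¹| * (C' * ‖h‖)) (fun s => hC _) (fun s => ?_)
    · change ∫ s, fderiv ℝ f (y + (c⁻¹ * s) • h) h ∂_ = ∫ s, f (y + (c⁻¹ * s) • h) * s ∂_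
      rw [← st, integral_const_mul, hvc, mul_inv_cancel_left₀ hcne]
    · have d1 : HasDerivAt (fun s : ℝ => y + (c⁻¹ * s) • h) (c⁻¹ • h) s := by
        simpa using ((((hasDerivAt_id s).const_mul c⁻¹).smul_const h).const_add y)
      have d2 := ((hf.differentiable (by simp)) (y + (c⁻¹ * s) • h)).hasFDerivAt.comp_hasDerivAt s d1
      refine d2.congr_deriv ?_
      simp
    · exact continuous_const.mul ((hf'c.comp (by fun_prop)).clm_apply continuous_const)
    · rw [abs_mul]
      refine mul_le_mul_of_nonneg_left ?_ (abs_nonneg _)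
      exact (ContinuousLinearMap.le_opNorm _ _).trans
          (mul_le_mul_of_nonneg_right (hC' _) (norm_nonneg _))

end Banach

end WGauss

namespace WGauss

/-! ### Integration by parts for the weighted measure -/

section Closure

variable {X E G : Type*} [MeasurableSpace X]
  [NormedAddCommGroup E] [NormedSpace ℝ E] [NormedAddCommGroup G] [NormedSpace ℝ G]
  {T : Submodule ℝ (X → E)}

/-- Almost everywhere convergence, obtained along a subsequence, is what nonlinear compositions θ(u
n) need in order to converge by domination. -/
theorem HasGrad.exists_seq_ae {D : T →ₗ[ℝ] (X → G)} {m : Measure X} {p : ℝ≥0∞} (hp : p ≠ 0)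
    {F : X → E} {Φ : X → G} (h : HasGrad D m p F Φ) :
    ∃ u : ℕ → T,
      (∀ n, MemLp (u n : X → E) p m ∧ MemLp (D (u n)) p m) ∧
      Tendsto (fun n => eLpNorm ((u n : X → E) - F) p m) atTop (𝓝 0) ∧
      Tendsto (fun n => eLpNorm (D (u n) - Φ) p m) atTop (𝓝 0) ∧
      ∀ᵐ x ∂m, Tendsto (fun n => (u n : X → E) x) atTop (𝓝 (F x)) := by
  obtain ⟨h1, h2, u, hu, h3, h4⟩ := h
  obtain ⟨ns, hns, hae⟩ := (tendstoInMeasure_of_tendsto_eLpNorm hp (fun n => (hu n).1.1) h1.1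
    h3).exists_seq_tendsto_ae
  exact ⟨fun n => u (ns n), fun n => hu _, h3.comp hns.tendsto_atTop, h4.comp hns.tendsto_atTop,
    hae⟩

end Closure

/-- Convergence of integrals of products under norm convergence of one factor. -/
theorem tendsto_integral_mul {X : Type*} [MeasurableSpace X] {m : Measure X} {p q : ℝ≥0∞}
    [ENNReal.HolderConjugate p q] {u : ℕ → X → ℝ} {v F : X → ℝ} (hu : ∀ n, MemLp (u n) p m)
    (hF : MemLp F p m) (hv : MemLp v q m)
    (h : Tendsto (fun n => eLpNorm (u n - F) p m) atTop (𝓝 0)) :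
    Tendsto (fun n => ∫ x, u n x * v x ∂m) atTop (𝓝 (∫ x, F x * v x ∂m)) := by
  refine tendsto_integral_of_L1' _ (hF.integrable_mul hv).1
    (Eventually.of_forall fun n => (hu n).integrable_mul hv) ?_
  have h0 : Tendsto (fun n => eLpNorm (u n - F) p m * eLpNorm v q m) atTop (𝓝 0) := by
    simpa using ENNReal.Tendsto.mul_const h (Or.inr hv.2.ne)
  refine tendsto_of_tendsto_of_tendsto_of_le_of_le tendsto_const_nhds h0 (fun _ => zero_le)
    fun n => ?_
  have := eLpNorm_smul_le_mul_eLpNorm (p := p) (q := q) (r := 1) hv.1 ((hu n).1.sub hF.1)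
  refine le_trans (le_of_eq ?_) this
  refine eLpNorm_congr_ae (ae_of_all _ fun x => ?_)
  simp [sub_mul]

theorem IsSmoothCylindrical.memLp {X : Type*} [NormedAddCommGroup X] [NormedSpace ℝ X]
    [MeasurableSpace X] [BorelSpace X] {f : X → ℝ} (hf : IsSmoothCylindrical f) (m : Measure X)
    [IsFiniteMeasure m] (p : ℝ≥0∞) : MemLp f p m := by
  obtain ⟨C, hC⟩ := hf.bddSmooth.exists_bound
  exact MemLp.of_bound hf.contDiff.continuous.stronglyMeasurable.aestronglyMeasurable C (ae_of_all _ hC)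

/-! ### Gradients of products and compositions; integration by parts against θ(L) for a Sobolev
function L -/

section Gaussian

variable {X : Type*} [NormedAddCommGroup X] [NormedSpace ℝ X] [CompleteSpace X]
  [SecondCountableTopology X] [MeasurableSpace X] [BorelSpace X]
  (μ : Measure X) [IsGaussian μ]

theorem inner_gradH (f : X → ℝ) (x : X) (h : CM μ) :
    inner ℝ (gradH μ f x) h = fderiv ℝ f x (incl μ h) := by
  rw [gradH, InnerProductSpace.toDual_symm_apply]
  rfl

theorem continuous_gradH {f : X → ℝ} (hf : ContDiff ℝ ∞ f) : Continuous (gradH μ f) :=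
  (differentiable_gradH μ hf).continuous

theorem IsSmoothCylindrical.exists_gradH_bound {f : X → ℝ} (hf : IsSmoothCylindrical f) :
    ∃ C, ∀ x, ‖gradH μ f x‖ ≤ C := by
  obtain ⟨C, hC⟩ := hf.bddSmooth.exists_fderiv_bound
  refine ⟨‖toHL μ‖ * C, fun x => ?_⟩
  rw [gradH_eq]
  exact ((toHL μ).le_opNorm _).trans (mul_le_mul_of_nonneg_left (hC x) (norm_nonneg _))

theorem IsSmoothCylindrical.memLp_gradH {f : X → ℝ} (hf : IsSmoothCylindrical f) (m : Measure X)
    [IsFiniteMeasure m] (p : ℝ≥0∞) : MemLp (gradH μ f) p m := by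
  obtain ⟨C, hC⟩ := hf.exists_gradH_bound μ
  exact MemLp.of_bound (continuous_gradH μ hf.contDiff).aestronglyMeasurable C (ae_of_all _ hC)

theorem gradH_mul {f g : X → ℝ} (hf : ContDiff ℝ ∞ f) (hg : ContDiff ℝ ∞ g) (x : X) :
    gradH μ (fun y => f y * g y) x = f x • gradH μ g x + g x • gradH μ f x := by
  refine ext_inner_right ℝ fun h => ?_
  rw [inner_add_left, real_inner_smul_left, real_inner_smul_left, inner_gradH, inner_gradH,
    inner_gradH, fderiv_fun_mul (hf.differentiable (by simp) x) (hg.differentiable (by simp) x)]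
  simp

theorem gradH_comp {θ : ℝ → ℝ} {f : X → ℝ} (hθ : ContDiff ℝ ∞ θ) (hf : ContDiff ℝ ∞ f) (x : X) :
    gradH μ (fun y => θ (f y)) x = deriv θ (f x) • gradH μ f x := by
  refine ext_inner_right ℝ fun h => ?_
  rw [real_inner_smul_left, inner_gradH, inner_gradH]
  have := ((hθ.differentiable (by simp) (f x)).hasDerivAt.comp_hasFDerivAt x
    (hf.differentiable (by simp) x).hasFDerivAt).fderiv
  change fderiv ℝ (θ ∘ f) x _ = _
  rw [this]
  simp

theorem IsSmoothCylindrical.integral_inner_gradH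
    (hcentered : ∀ l : StrongDual ℝ X, ∫ x, l x ∂μ = 0) {f : X → ℝ}
    (hf : IsSmoothCylindrical f) (l : StrongDual ℝ X) :
    ∫ x, inner ℝ (gradH μ f x) (toH μ l) ∂μ = ∫ x, f x * l x ∂μ := by
  obtain ⟨C, hC⟩ := hf.bddSmooth.exists_bound
  obtain ⟨C', hC'⟩ := hf.bddSmooth.exists_fderiv_bound
  simp only [inner_gradH]
  exact integral_fderiv_incl_toH μ hcentered l (hf.contDiff.of_le (mod_cast le_top)) hC hC'

/-- Integration by parts against a bounded smooth function of a Sobolev function. -/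
theorem integral_inner_gradH_mul_comp
    (hcentered : ∀ l : StrongDual ℝ X, ∫ x, l x ∂μ = 0) {t : ℝ≥0∞} (ht : 1 ≤ t)
    {L : X → ℝ} {Ψ : X → CM μ} (hL : HasGrad (gradOp μ) μ t L Ψ) {f : X → ℝ}
    (hf : IsSmoothCylindrical f) {θ : ℝ → ℝ} (hθ : BddSmooth θ) (l : StrongDual ℝ X) :
    ∫ x, inner ℝ (gradH μ f x) (toH μ l) * θ (L x) ∂μ
      = ∫ x, (f x * l x * θ (L x) - f x * inner ℝ (Ψ x) (toH μ l) * deriv θ (L x)) ∂μ := by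
  obtain ⟨u, hu, hu1, hu2, hu3⟩ := hL.exists_seq_ae (zero_lt_one.trans_le ht).ne'
  have hLm : MemLp L t μ := hL.1
  have hΨ : MemLp Ψ t μ := hL.2.1
  set h := toH μ l with hh
  have hcu : ∀ n, IsSmoothCylindrical (u n : X → ℝ) := fun n => isSmoothCylindrical_of_mem (u n).2
  obtain ⟨A, hA⟩ := hf.bddSmooth.exists_bound
  obtain ⟨A', hA'⟩ := hf.exists_gradH_bound μ
  obtain ⟨B, hB⟩ := hθ.exists_bound
  obtain ⟨B', hB'⟩ := hθ.exists_fderiv_bound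
  have hB'' : ∀ y, |deriv θ y| ≤ B' := fun y => by
    rw [← Real.norm_eq_abs, norm_deriv_eq_norm_fderiv]
    exact hB' y
  have hfc := hf.contDiff.continuous
  have hθc := hθ.1.continuous
  have hθ'c : Continuous (deriv θ) := hθ.1.continuous_deriv (mod_cast le_top)
  have hgc : Continuous fun x => inner ℝ (gradH μ f x) h :=
    (continuous_gradH μ hf.contDiff).inner continuous_const
  have hA0 : 0 ≤ A := (abs_nonneg _).trans (hA 0)
  have hB'0 : 0 ≤ B' := (norm_nonneg _).trans (hB' 0)
  have hΨh : MemLp (fun x => inner ℝ (Ψ x) h) t μ := hΨ.inner_const h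
  have hΨ1 : Integrable (fun x => inner ℝ (Ψ x) h) μ := hΨh.integrable ht
  have hG : ∀ x, |inner ℝ (gradH μ f x) h| ≤ A' * ‖h‖ := fun x =>
    (abs_real_inner_le_norm _ _).trans (mul_le_mul_of_nonneg_right (hA' x) (norm_nonneg _))
  have hli : Integrable l μ := IsGaussian.integrable_dual μ l
  -- the identity for the approximating functions
  have hn : ∀ n, ∫ x, inner ℝ (gradH μ f x) h * θ ((u n : X → ℝ) x) ∂μ
      = ∫ x, f x * l x * θ ((u n : X → ℝ) x) ∂μ
        - ∫ x, f x * inner ℝ (gradOp μ (u n) x) h * deriv θ ((u n : X → ℝ) x) ∂μ := by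
    intro n
    have e := (hf.mul (IsSmoothCylindrical.comp hθ (hcu n))).integral_inner_gradH μ hcentered l
    have e1 : ∀ x, inner ℝ (gradH μ (fun y => f y * θ ((u n : X → ℝ) y)) x) (toH μ l)
        = f x * inner ℝ (gradOp μ (u n) x) h * deriv θ ((u n : X → ℝ) x)
          + inner ℝ (gradH μ f x) h * θ ((u n : X → ℝ) x) := fun x => by
      rw [gradH_mul μ (g := fun y => θ ((u n : X → ℝ) y)) hf.contDiff
          (hθ.1.comp (hcu n).contDiff), gradH_comp μ hθ.1 (hcu n).contDiff,
        inner_add_left, real_inner_smul_left, real_inner_smul_left, real_inner_smul_left]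
      change _ = f x * inner ℝ (gradH μ (u n) x) h * _ + _
      ring
    simp only [e1] at e
    have hunc := (hcu n).contDiff.continuous
    obtain ⟨K, hK⟩ := (hcu n).exists_gradH_bound μ
    rw [integral_add] at e
    · rw [eq_sub_iff_add_eq, add_comm, e]
      exact integral_congr_ae (ae_of_all _ fun x => by ring)
    · refine Integrable.of_bound (Continuous.aestronglyMeasurable ?_) (A * (K * ‖h‖) * B')
        (ae_of_all _ fun x => ?_)
      · exact (hfc.mul ((continuous_gradH μ (hcu n).contDiff).inner continuous_const)).mul
          (hθ'c.comp hunc)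
      · rw [Real.norm_eq_abs, abs_mul, abs_mul]
        have hK0 : 0 ≤ K := (norm_nonneg _).trans (hK x)
        gcongr
        · exact hA x
        · exact (abs_real_inner_le_norm _ _).trans
            (mul_le_mul_of_nonneg_right (hK x) (norm_nonneg _))
        · exact hB'' _
    · refine Integrable.of_bound (Continuous.aestronglyMeasurable (hgc.mul (hθc.comp hunc)))
        (A' * ‖h‖ * B) (ae_of_all _ fun x => ?_)
      rw [Real.norm_eq_abs, abs_mul]
      exact mul_le_mul (hG x) (hB _) (abs_nonneg _) ((abs_nonneg _).trans (hG x))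
  -- passage to the limit
  have l1 : Tendsto (fun n => ∫ x, inner ℝ (gradH μ f x) h * θ ((u n : X → ℝ) x) ∂μ) atTop
      (𝓝 (∫ x, inner ℝ (gradH μ f x) h * θ (L x) ∂μ)) := by
    refine tendsto_integral_of_dominated_convergence (fun _ => A' * ‖h‖ * B)
      (fun n => (hgc.mul (hθc.comp (hcu n).contDiff.continuous)).aestronglyMeasurable)
      (integrable_const _) (fun n => ae_of_all _ fun x => ?_) ?_
    · rw [Real.norm_eq_abs, abs_mul]
      exact mul_le_mul (hG x) (hB _) (abs_nonneg _) ((abs_nonneg _).trans (hG x))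
    · filter_upwards [hu3] with x hx
      exact ((hθc.tendsto _).comp hx).const_mul _
  have l2 : Tendsto (fun n => ∫ x, f x * l x * θ ((u n : X → ℝ) x) ∂μ) atTop
      (𝓝 (∫ x, f x * l x * θ (L x) ∂μ)) := by
    refine tendsto_integral_of_dominated_convergence (fun x => A * |l x| * B)
      (fun n => ((hfc.mul l.continuous).mul
        (hθc.comp (hcu n).contDiff.continuous)).aestronglyMeasurable)
      ((hli.abs.const_mul A).mul_const B) (fun n => ae_of_all _ fun x => ?_) ?_
    · rw [Real.norm_eq_abs, abs_mul, abs_mul]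
      gcongr
      · exact hA x
      · exact hB _
    · filter_upwards [hu3] with x hx
      exact ((hθc.tendsto _).comp hx).const_mul _
  -- The gradients converge only in norm and the factors θ'(u n) only pointwise. Hence ∇u n is split
  -- as Ψ + (∇u n - Ψ): domination handles the first part, and boundedness of f and θ' together with
  -- the norm convergence handles the second (`l4`).
  have l3 : Tendsto (fun n => ∫ x, f x * inner ℝ (Ψ x) h * deriv θ ((u n : X → ℝ) x) ∂μ) atTop
      (𝓝 (∫ x, f x * inner ℝ (Ψ x) h * deriv θ (L x) ∂μ)) := by
    refine tendsto_integral_of_dominated_convergence (fun x => A * |inner ℝ (Ψ x) h| * B')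
      (fun n => (hfc.aestronglyMeasurable.mul hΨh.1).mul
        (hθ'c.comp (hcu n).contDiff.continuous).aestronglyMeasurable)
      ((hΨ1.abs.const_mul A).mul_const B') (fun n => ae_of_all _ fun x => ?_) ?_
    · rw [Real.norm_eq_abs, abs_mul, abs_mul]
      gcongr
      · exact hA x
      · exact hB'' _
    · filter_upwards [hu3] with x hx
      exact ((hθ'c.tendsto _).comp hx).const_mul _
  have i3 : ∀ n, Integrable (fun x => f x * inner ℝ (Ψ x) h * deriv θ ((u n : X → ℝ) x)) μ := by
    intro n
    refine Integrable.mono' ((hΨ1.abs.const_mul A).mul_const B')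
      ((hfc.aestronglyMeasurable.mul hΨh.1).mul
        (hθ'c.comp (hcu n).contDiff.continuous).aestronglyMeasurable) (ae_of_all _ fun x => ?_)
    rw [Real.norm_eq_abs, abs_mul, abs_mul]
    gcongr
    · exact hA x
    · exact hB'' _
  have i4 : ∀ n, Integrable
      (fun x => f x * inner ℝ (gradOp μ (u n) x - Ψ x) h * deriv θ ((u n : X → ℝ) x)) μ := by
    intro n
    have hm : MemLp (fun x => inner ℝ (gradOp μ (u n) x - Ψ x) h) t μ :=
      ((hu n).2.sub hΨ).inner_const h
    refine Integrable.mono' (((hm.integrable ht).abs.const_mul A).mul_const B')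
      ((hfc.aestronglyMeasurable.mul hm.1).mul
        (hθ'c.comp (hcu n).contDiff.continuous).aestronglyMeasurable) (ae_of_all _ fun x => ?_)
    rw [Real.norm_eq_abs, abs_mul, abs_mul]
    gcongr
    · exact hA x
    · exact hB'' _
  have l4 : Tendsto (fun n => ∫ x, f x * inner ℝ (gradOp μ (u n) x - Ψ x) h
      * deriv θ ((u n : X → ℝ) x) ∂μ) atTop (𝓝 0) := by
    have h0 := tendsto_integral_of_L1' (μ := μ) (f := fun _ => (0 : ℝ))
      (F := fun n x => f x * inner ℝ (gradOp μ (u n) x - Ψ x) h * deriv θ ((u n : X → ℝ) x))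
      (l := atTop) aestronglyMeasurable_const (Eventually.of_forall i4) ?_
    · simpa using h0
    · have hK : Tendsto (fun n => ENNReal.ofReal (A * ‖h‖ * B') * eLpNorm (gradOp μ (u n) - Ψ) t μ)
          atTop (𝓝 0) := by
        simpa using ENNReal.Tendsto.const_mul hu2 (Or.inr ENNReal.ofReal_ne_top)
      refine tendsto_of_tendsto_of_tendsto_of_le_of_le tendsto_const_nhds hK (fun _ => zero_le)
        fun n => ?_
      refine (eLpNorm_le_mul_eLpNorm_of_ae_le_mul (g := gradOp μ (u n) - Ψ) (c := A * ‖h‖ * B')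
        (ae_of_all _ fun x => ?_) 1).trans ?_
      · simp only [Pi.sub_apply, sub_zero]
        rw [Real.norm_eq_abs, abs_mul, abs_mul]
        calc |f x| * |inner ℝ (gradOp μ (u n) x - Ψ x) h| * |deriv θ ((u n : X → ℝ) x)|
            ≤ A * (‖gradOp μ (u n) x - Ψ x‖ * ‖h‖) * B' := by
              gcongr
              · exact hA x
              · exact abs_real_inner_le_norm _ _
              · exact hB'' _
          _ = _ := by ring
      · gcongr
        exact eLpNorm_le_eLpNorm_of_exponent_le ht ((hu n).2.1.sub hΨ.1)
  have l5 := l3.add l4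
  rw [add_zero] at l5
  have e5 : ∀ n, ∫ x, f x * inner ℝ (gradOp μ (u n) x) h * deriv θ ((u n : X → ℝ) x) ∂μ
      = ∫ x, f x * inner ℝ (Ψ x) h * deriv θ ((u n : X → ℝ) x) ∂μ
        + ∫ x, f x * inner ℝ (gradOp μ (u n) x - Ψ x) h * deriv θ ((u n : X → ℝ) x) ∂μ := by
    intro n
    rw [← integral_add (i3 n) (i4 n)]
    refine integral_congr_ae (ae_of_all _ fun x => ?_)
    simp only [inner_sub_left]
    ring
  simp only [← e5] at l5
  have key := tendsto_nhds_unique l1 ((l2.sub l5).congr fun n => (hn n).symm)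
  rw [key, integral_sub]
  · refine Integrable.mono' ((hli.abs.const_mul A).mul_const B)
      ((hfc.aestronglyMeasurable.mul l.continuous.aestronglyMeasurable).mul
        (hθc.comp_aestronglyMeasurable hLm.1)) (ae_of_all _ fun x => ?_)
    rw [Real.norm_eq_abs, abs_mul, abs_mul]
    gcongr
    · exact hA x
    · exact hB _
  · refine Integrable.mono' ((hΨ1.abs.const_mul A).mul_const B')
      ((hfc.aestronglyMeasurable.mul hΨh.1).mul
        (hθ'c.comp_aestronglyMeasurable hLm.1)) (ae_of_all _ fun x => ?_)
    rw [Real.norm_eq_abs, abs_mul, abs_mul]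
    gcongr
    · exact hA x
    · exact hB'' _

end Gaussian

end WGauss

namespace WGauss

/-! ### Change of measure and exponent -/

section Transfer

variable {X E G : Type*} [MeasurableSpace X]
  [NormedAddCommGroup E] [NormedSpace ℝ E] [NormedAddCommGroup G] [NormedSpace ℝ G]
  {T : Submodule ℝ (X → E)}

/-- Continuous inclusion of `Lᵖ(m)` in `Lᵃ(m')`. -/
def LpLe (m : Measure X) (p : ℝ≥0∞) (m' : Measure X) (a : ℝ≥0∞) (C : ℝ≥0) : Prop :=
  m' ≪ m ∧ ∀ g : X → ℝ, AEStronglyMeasurable g m → eLpNorm g a m' ≤ C * eLpNorm g p m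

/-- Only norms matter, so the estimate for real functions covers H-valued and Hilbert–Schmidt-valued
ones. -/
theorem LpLe.eLpNorm_le {m m' : Measure X} {p a : ℝ≥0∞} {C : ℝ≥0} (h : LpLe m p m' a C)
    {E : Type*} [NormedAddCommGroup E] {g : X → E} (hg : AEStronglyMeasurable g m) :
    eLpNorm g a m' ≤ C * eLpNorm g p m := by
  rw [← eLpNorm_norm g, ← eLpNorm_norm g]
  exact h.2 _ hg.norm

theorem LpLe.memLp {m m' : Measure X} {p a : ℝ≥0∞} {C : ℝ≥0} (h : LpLe m p m' a C)
    {E : Type*} [NormedAddCommGroup E] {g : X → E} (hg : MemLp g p m) : MemLp g a m' :=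
  ⟨hg.1.mono_ac h.1,
    (h.eLpNorm_le hg.1).trans_lt (ENNReal.mul_lt_top ENNReal.coe_lt_top hg.2)⟩

theorem LpLe.tendsto {m m' : Measure X} {p a : ℝ≥0∞} {C : ℝ≥0} (h : LpLe m p m' a C)
    {E : Type*} [NormedAddCommGroup E] {g : ℕ → X → E} (hg : ∀ n, AEStronglyMeasurable (g n) m)
    (ht : Tendsto (fun n => eLpNorm (g n) p m) atTop (𝓝 0)) :
    Tendsto (fun n => eLpNorm (g n) a m') atTop (𝓝 0) := by
  have h0 : Tendsto (fun n => (C : ℝ≥0∞) * eLpNorm (g n) p m) atTop (𝓝 0) := by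
    simpa using ENNReal.Tendsto.const_mul ht (Or.inr ENNReal.coe_ne_top)
  exact tendsto_of_tendsto_of_tendsto_of_le_of_le tendsto_const_nhds h0 (fun _ => zero_le)
    fun n => h.eLpNorm_le (hg n)

/-- The approximating sequence is kept: its convergence in the larger norm implies convergence in
the smaller one. -/
theorem HasGrad.transfer {D : T →ₗ[ℝ] (X → G)} {m m' : Measure X} {p a : ℝ≥0∞} {C : ℝ≥0}
    (h : LpLe m p m' a C) {F : X → E} {Φ : X → G} (hF : HasGrad D m p F Φ) :
    HasGrad D m' a F Φ := by
  obtain ⟨h1, h2, u, hu, h3, h4⟩ := hF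
  exact ⟨h.memLp h1, h.memLp h2, u, fun n => ⟨h.memLp (hu n).1, h.memLp (hu n).2⟩,
    h.tendsto (fun n => (hu n).1.1.sub h1.1) h3, h.tendsto (fun n => (hu n).2.1.sub h2.1) h4⟩

/-- With mutual absolute continuity the null sets agree, so the identity is well defined and
injective on classes. -/
theorem LpLe.embeds {m m' : Measure X} {p a : ℝ≥0∞} {C : ℝ≥0} (h : LpLe m p m' a C)
    (h' : m ≪ m') (D : T →ₗ[ℝ] (X → G)) : Embeds D m p m' a := by
  refine ⟨⟨C, fun F Φ hF => ⟨hF.transfer h, ?_⟩⟩, fun F F' _ _ => ⟨fun e => h.1.ae_eq e,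
    fun e => h'.ae_eq e⟩⟩
  rw [wNorm, wNorm, mul_add]
  exact add_le_add (h.eLpNorm_le hF.1.1) (h.eLpNorm_le hF.2.1.1)

theorem lpLe_of_exponent_le (m : Measure X) [IsFiniteMeasure m] {p a : ℝ≥0∞} (hpa : a ≤ p) :
    ∃ C, LpLe m p m a C := by
  rcases eq_or_ne m 0 with rfl | hm
  · exact ⟨0, Measure.AbsolutelyContinuous.rfl, fun g _ => by simp⟩
  rcases eq_or_ne a 0 with rfl | ha
  · exact ⟨0, Measure.AbsolutelyContinuous.rfl, fun g _ => by simp⟩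
  have hne : (m Set.univ) ^ (1 / a.toReal - 1 / p.toReal) ≠ ⊤ := by
    refine ENNReal.rpow_ne_top_of_ne_zero ?_ (measure_ne_top _ _)
    simpa using hm
  refine ⟨((m Set.univ) ^ (1 / a.toReal - 1 / p.toReal)).toNNReal,
    Measure.AbsolutelyContinuous.rfl, fun g hg => ?_⟩
  rw [ENNReal.coe_toNNReal hne, mul_comm]
  exact eLpNorm_le_eLpNorm_mul_rpow_measure_univ hpa hg

theorem LpLe.trans {m m' m'' : Measure X} {p a b : ℝ≥0∞} {C C' : ℝ≥0} (h : LpLe m p m' a C)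
    (h' : LpLe m' a m'' b C') : LpLe m p m'' b (C' * C) := by
  refine ⟨h'.1.trans h.1, fun g hg => (h'.2 g (hg.mono_ac h.1)).trans ?_⟩
  rw [ENNReal.coe_mul, mul_assoc]
  gcongr
  exact h.2 g hg

end Transfer

/-! ### Hölder comparison of Lebesgue spaces for μ and wμ -/

section Weighted

variable {X : Type*} [MeasurableSpace X] {μ : Measure X} {w : X → ℝ}

theorem weighted_absolutelyContinuous (μ : Measure X) (w : X → ℝ) : weighted μ w ≪ μ :=
  withDensity_absolutelyContinuous _ _

theorem absolutelyContinuous_weighted (hwm : AEMeasurable w μ) (hwpos : ∀ᵐ x ∂μ, 0 < w x) :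
    μ ≪ weighted μ w := by
  refine withDensity_absolutelyContinuous' hwm.ennreal_ofReal ?_
  filter_upwards [hwpos] with x hx
  simpa using hx

theorem lintegral_weighted (hwm : AEMeasurable w μ) {g : X → ℝ≥0∞} (hg : AEMeasurable g μ) :
    ∫⁻ x, g x ∂(weighted μ w) = ∫⁻ x, ENNReal.ofReal (w x) * g x ∂μ :=
  lintegral_withDensity_eq_lintegral_mul₀ hwm.ennreal_ofReal hg

theorem integral_weighted (hwm : AEMeasurable w μ) (hwpos : ∀ᵐ x ∂μ, 0 < w x) (g : X → ℝ) :
    ∫ x, g x ∂(weighted μ w) = ∫ x, w x * g x ∂μ := by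
  rw [weighted, integral_withDensity_eq_integral_toReal_smul₀ hwm.ennreal_ofReal
    (ae_of_all _ fun x => ENNReal.ofReal_lt_top)]
  refine integral_congr_ae ?_
  filter_upwards [hwpos] with x hx
  rw [ENNReal.toReal_ofReal hx.le, smul_eq_mul]

theorem isFiniteMeasure_weighted (hw : Integrable w μ) : IsFiniteMeasure (weighted μ w) :=
  isFiniteMeasure_withDensity_ofReal hw.2

/-- If `w ∈ Lˢ(μ)`, then `L^{p s'}(μ)` is contained in `Lᵖ(w μ)`. -/
theorem lpLe_weighted {s s' : ℝ} (hs : s.HolderConjugate s') (hw : MemLp w (ENNReal.ofReal s) μ)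
    {p : ℝ} (hp : 0 < p) :
    ∃ C, LpLe μ (ENNReal.ofReal (p * s')) (weighted μ w) (ENNReal.ofReal p) C := by
  have hwm : AEMeasurable w μ := hw.1.aemeasurable
  have hsp : 0 < s := hs.pos
  have hsp' : 0 < s' := hs.symm.pos
  -- The L^s norm of the positive part of w, as it appears in Hölder's inequality for the product w
  -- · |g|^p; taking p-th roots turns it into the constant K^{1/p}.
  set K : ℝ≥0∞ := (∫⁻ x, ENNReal.ofReal (w x) ^ s ∂μ) ^ (1 / s) with hK
  have hKt : K ≠ ⊤ := by
    refine ENNReal.rpow_ne_top_of_nonneg (by positivity) ?_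
    have h1 := hw.eLpNorm_lt_top
    rw [eLpNorm_lt_top_iff_lintegral_rpow_enorm_lt_top (by simpa using hsp) (by simp),
      ENNReal.toReal_ofReal hsp.le] at h1
    refine ((lintegral_mono fun x => ?_).trans_lt h1).ne
    gcongr
    exact Real.ofReal_le_enorm _
  have hKp : K ^ (1 / p) ≠ ⊤ := ENNReal.rpow_ne_top_of_nonneg (by positivity) hKt
  refine ⟨(K ^ (1 / p)).toNNReal, weighted_absolutelyContinuous μ w, fun g hg => ?_⟩
  rw [ENNReal.coe_toNNReal hKp]
  rw [eLpNorm_eq_lintegral_rpow_enorm_toReal (by simpa using hp) (by simp),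
    eLpNorm_eq_lintegral_rpow_enorm_toReal (by simp only [ne_eq, ENNReal.ofReal_eq_zero, not_le]; positivity) (by simp),
    ENNReal.toReal_ofReal hp.le, ENNReal.toReal_ofReal (by positivity)]
  have hgm : AEMeasurable (fun x => ‖g x‖ₑ ^ p) μ := hg.enorm.pow_const _
  rw [lintegral_weighted hwm hgm]
  have hol := ENNReal.lintegral_mul_le_Lp_mul_Lq μ hs hwm.ennreal_ofReal hgm
  have e : (∫⁻ x, ‖g x‖ₑ ^ (p * s') ∂μ) ^ (1 / (p * s'))
      = ((∫⁻ x, (‖g x‖ₑ ^ p) ^ s' ∂μ) ^ (1 / s')) ^ (1 / p) := by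
    simp only [← ENNReal.rpow_mul]
    congr 1
    field_simp
  rw [e, ← ENNReal.mul_rpow_of_nonneg _ _ (by positivity)]
  exact ENNReal.rpow_le_rpow hol (by positivity)

/-- If `w^{r/(r-1)} ∈ L¹(μ)`, then `Lᵖ(w μ)` is contained in `L^{p r}(μ)`. -/
theorem weighted_lpLe (hwm : AEMeasurable w μ) (hwpos : ∀ᵐ x ∂μ, 0 < w x) {r : ℝ} (hr0 : 0 < r)
    (hr1 : r < 1) (hint : Integrable (fun x => w x ^ (r / (r - 1))) μ) {p : ℝ} (hp : 0 < p) :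
    ∃ C, LpLe (weighted μ w) (ENNReal.ofReal p) μ (ENNReal.ofReal (p * r)) C := by
  have h1r : 0 < 1 - r := by linarith
  -- Hölder is applied to |g|^{pr} = (w|g|^p)^r · w^{-r}. The power 1/r of the first factor is the
  -- integrand for wμ, and the power 1/(1-r) of the second is w^{r/(r-1)}, integrable by assumption.
  have hconj : (1 / r).HolderConjugate (1 / (1 - r)) := by
    refine Real.holderConjugate_iff.2 ⟨?_, ?_⟩
    · rw [one_div]
      exact (one_lt_inv₀ hr0).2 hr1
    · simp
  set K : ℝ≥0∞ := (∫⁻ x, (ENNReal.ofReal (w x) ^ (-r)) ^ (1 / (1 - r)) ∂μ) ^ (1 / (1 / (1 - r)))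
    with hK
  have hKt : K ≠ ⊤ := by
    refine ENNReal.rpow_ne_top_of_nonneg (by positivity) ?_
    have h1 := hint.2
    rw [hasFiniteIntegral_iff_enorm] at h1
    refine ne_of_lt (lt_of_le_of_lt (lintegral_mono_ae ?_) h1)
    filter_upwards [hwpos] with x hx
    rw [← ENNReal.rpow_mul, ENNReal.ofReal_rpow_of_pos hx]
    have : -r * (1 / (1 - r)) = r / (r - 1) := by
      have h2 : r - 1 ≠ 0 := by linarith
      field_simp
      ring
    rw [this]
    exact Real.ofReal_le_enorm _
  have hKp : K ^ (1 / (p * r)) ≠ ⊤ := ENNReal.rpow_ne_top_of_nonneg (by positivity) hKt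
  refine ⟨(K ^ (1 / (p * r))).toNNReal, absolutelyContinuous_weighted hwm hwpos, fun g hg => ?_⟩
  rw [ENNReal.coe_toNNReal hKp]
  have hgμ : AEStronglyMeasurable g μ := hg.mono_ac (absolutelyContinuous_weighted hwm hwpos)
  rw [eLpNorm_eq_lintegral_rpow_enorm_toReal (by simp only [ne_eq, ENNReal.ofReal_eq_zero, not_le]; positivity) (by simp),
    eLpNorm_eq_lintegral_rpow_enorm_toReal (by simpa using hp) (by simp),
    ENNReal.toReal_ofReal hp.le, ENNReal.toReal_ofReal (by positivity)]
  have hgm : AEMeasurable (fun x => ‖g x‖ₑ ^ p) μ := hgμ.enorm.pow_const _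
  rw [lintegral_weighted hwm hgm]
  have hol := ENNReal.lintegral_mul_le_Lp_mul_Lq μ hconj
    (f := fun x => (ENNReal.ofReal (w x) * ‖g x‖ₑ ^ p) ^ r)
    (g := fun x => ENNReal.ofReal (w x) ^ (-r)) ((hwm.ennreal_ofReal.mul hgm).pow_const _)
    (hwm.ennreal_ofReal.pow_const _)
  have e1 : ∫⁻ x, ‖g x‖ₑ ^ (p * r) ∂μ = ∫⁻ x, ((fun x => (ENNReal.ofReal (w x) * ‖g x‖ₑ ^ p) ^ r)
      * fun x => ENNReal.ofReal (w x) ^ (-r)) x ∂μ := by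
    refine lintegral_congr_ae ?_
    filter_upwards [hwpos] with x hx
    have h0 : ENNReal.ofReal (w x) ≠ 0 := by simpa using hx
    simp only [Pi.mul_apply]
    rw [ENNReal.mul_rpow_of_nonneg _ _ hr0.le, ← ENNReal.rpow_mul, mul_right_comm,
      ← ENNReal.rpow_add _ _ h0 ENNReal.ofReal_ne_top]
    simp
  rw [e1]
  have e2 : (∫⁻ x, ENNReal.ofReal (w x) * ‖g x‖ₑ ^ p ∂μ) ^ (1 / p)
      = ((∫⁻ x, ((ENNReal.ofReal (w x) * ‖g x‖ₑ ^ p) ^ r) ^ (1 / r) ∂μ) ^ (1 / (1 / r)))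
        ^ (1 / (p * r)) := by
    simp only [← ENNReal.rpow_mul]
    have h3 : r * (1 / r) = 1 := by field_simp
    simp only [h3, ENNReal.rpow_one]
    congr 1
    field_simp
  rw [e2, mul_comm (K ^ (1 / (p * r))), ← ENNReal.mul_rpow_of_nonneg _ _ (by positivity)]
  exact ENNReal.rpow_le_rpow hol (by positivity)

end Weighted

end WGauss

namespace WGauss

/-! ### Truncated exponentials and integration by parts for the weighted measure -/

/-- Smooth compactly supported truncations of the exponential function. -/
theorem exists_truncated_exp : ∃ (θ : ℕ → ℝ → ℝ) (M : ℝ), (∀ k, BddSmooth (θ k)) ∧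
    (∀ k y, |θ k y| ≤ Real.exp y) ∧ (∀ k y, |deriv (θ k) y| ≤ M * Real.exp y) ∧
    (∀ y, Tendsto (fun k => θ k y) atTop (𝓝 (Real.exp y))) ∧
    ∀ y, Tendsto (fun k => deriv (θ k) y) atTop (𝓝 (Real.exp y)) := by
  -- The truncations are e^y ρ(y/(k+1)). Dilating by k+1 ≥ 1 keeps the cutoffs and their derivatives
  -- bounded uniformly in k, so θ_k and θ_k' are dominated by a multiple of e^y; at y = log w this
  -- is a multiple of w.
  let ρ : ContDiffBump (0 : ℝ) := ⟨1, 2, one_pos, one_lt_two⟩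
  have hρ : ContDiff ℝ ∞ ρ := ρ.contDiff
  obtain ⟨M, hM⟩ := (bddSmooth_of_hasCompactSupport hρ ρ.hasCompactSupport).exists_fderiv_bound
  have hM' : ∀ y, |deriv ρ y| ≤ M := fun y => by
    rw [← Real.norm_eq_abs, norm_deriv_eq_norm_fderiv]
    exact hM y
  have hM0 : 0 ≤ M := (norm_nonneg _).trans (hM 0)
  set c : ℕ → ℝ := fun k => 1 / ((k : ℝ) + 1) with hc
  have hc0 : ∀ k, 0 < c k := fun k => Nat.one_div_pos_of_nat
  have hc1 : ∀ k, c k ≤ 1 := fun k => by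
    rw [hc]
    simp only
    rw [div_le_one (by positivity)]
    have : (0 : ℝ) ≤ k := k.cast_nonneg
    linarith
  have hct : Tendsto c atTop (𝓝 0) := tendsto_one_div_add_atTop_nhds_zero_nat
  have hρy : ∀ y, Tendsto (fun k => ρ (c k * y)) atTop (𝓝 1) := fun y => by
    have h1 : Tendsto (fun k => c k * y) atTop (𝓝 0) := by simpa using hct.mul_const y
    have h2 := (hρ.continuous.tendsto 0).comp h1
    rwa [ρ.one_of_mem_closedBall (by simp [ρ.rIn_pos.le])] at h2
  have hd : ∀ k y, HasDerivAt (fun y => Real.exp y * ρ (c k * y))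
      (Real.exp y * ρ (c k * y) + Real.exp y * (deriv ρ (c k * y) * c k)) y := fun k y => by
    have h1 : HasDerivAt (fun y => c k * y) (c k) y := by
      simpa using (hasDerivAt_id y).const_mul (c k)
    have h2 := ((hρ.differentiable (by simp) (c k * y)).hasDerivAt).comp y h1
    exact (Real.hasDerivAt_exp y).mul h2
  refine ⟨fun k y => Real.exp y * ρ (c k * y), 1 + M, fun k => ?_, fun k y => ?_, fun k y => ?_,
    fun y => ?_, fun y => ?_⟩
  · refine bddSmooth_of_hasCompactSupport
      (Real.contDiff_exp.mul (hρ.comp (contDiff_const.mul contDiff_id))) ?_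
    refine HasCompactSupport.mul_left ?_
    exact ρ.hasCompactSupport.comp_homeomorph (Homeomorph.mulLeft₀ (c k) (hc0 k).ne')
  · rw [abs_mul, abs_of_pos (Real.exp_pos y), abs_of_nonneg ρ.nonneg]
    exact mul_le_of_le_one_right (Real.exp_pos y).le ρ.le_one
  · rw [(hd k y).deriv, ← mul_add, abs_mul, abs_of_pos (Real.exp_pos y), mul_comm]
    refine mul_le_mul_of_nonneg_right ?_ (Real.exp_pos y).le
    refine (abs_add_le _ _).trans (add_le_add ?_ ?_)
    · rw [abs_of_nonneg ρ.nonneg]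
      exact ρ.le_one
    · rw [abs_mul, abs_of_pos (hc0 k)]
      exact (mul_le_mul (hM' _) (hc1 k) (hc0 k).le hM0).trans (mul_one M).le
  · simpa using (hρy y).const_mul (Real.exp y)
  · simp only [(hd _ y).deriv]
    have h3 : Tendsto (fun k => deriv ρ (c k * y) * c k) atTop (𝓝 0) := by
      refine squeeze_zero_norm (a := fun k => M * c k) (fun k => ?_)
        (by simpa using hct.const_mul M)
      rw [norm_mul, Real.norm_eq_abs, Real.norm_eq_abs, abs_of_pos (hc0 k)]
      exact mul_le_mul_of_nonneg_right (hM' _) (hc0 k).le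
    simpa using ((hρy y).const_mul (Real.exp y)).add (h3.const_mul (Real.exp y))

/-! ### Integration by parts for wμ -/

section Gaussian

variable {X : Type*} [NormedAddCommGroup X] [NormedSpace ℝ X] [CompleteSpace X]
  [SecondCountableTopology X] [MeasurableSpace X] [BorelSpace X]
  (μ : Measure X) [IsGaussian μ]

/-- The logarithmic derivative of `w μ` along `R_μ l`, where `Ψ` is the gradient of `log w`,
up to sign. -/
noncomputable def logDeriv (Ψ : X → CM μ) (l : StrongDual ℝ X) (x : X) : ℝ := l x - inner ℝ (Ψ x) (toH μ l)

theorem memLp_logDeriv {t : ℝ≥0∞} (ht : t ≠ ⊤) {Ψ : X → CM μ} (hΨ : MemLp Ψ t μ)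
    (l : StrongDual ℝ X) : MemLp (logDeriv μ Ψ l) t μ :=
  (memLp_dual μ l ht).sub (hΨ.inner_const _)

/-- Formally w = exp(log w) and ∇_H w = w ∇_H log w. The identity for μ is used with θ_k(log w) and
k → ∞; the dominating functions are multiples of |w|, |w||l| and |w||⟨Ψ, R_μ l⟩|, integrable because
w is in L^s and the other factors are in L^{s'}, which for Ψ is where s' ≤ t enters. -/
theorem integral_inner_gradH_weighted
    (hcentered : ∀ l : StrongDual ℝ X, ∫ x, l x ∂μ = 0) {s s' t : ℝ} (hs : s.HolderConjugate s')
    (ht : s' ≤ t) {w : X → ℝ} (hwpos : ∀ᵐ x ∂μ, 0 < w x) (hw : MemLp w (ENNReal.ofReal s) μ)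
    {Ψ : X → CM μ}
    (hlogw : HasGrad (gradOp μ) μ (ENNReal.ofReal t) (fun x => Real.log (w x)) Ψ)
    {f : X → ℝ} (hf : IsSmoothCylindrical f) (l : StrongDual ℝ X) :
    ∫ x, inner ℝ (gradH μ f x) (toH μ l) ∂(weighted μ w)
      = ∫ x, f x * logDeriv μ Ψ l x ∂(weighted μ w) := by
  have hwm : AEMeasurable w μ := hw.1.aemeasurable
  have ht1 : 1 ≤ ENNReal.ofReal t := by
    rw [← ENNReal.ofReal_one]
    exact ENNReal.ofReal_le_ofReal (hs.symm.lt.le.trans ht)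
  have hconj : ENNReal.HolderConjugate (ENNReal.ofReal s) (ENNReal.ofReal s') :=
    hs.ennrealOfReal
  have hs1 : 1 ≤ ENNReal.ofReal s := by
    rw [← ENNReal.ofReal_one]
    exact ENNReal.ofReal_le_ofReal hs.lt.le
  rw [integral_weighted hwm hwpos, integral_weighted hwm hwpos]
  obtain ⟨θ, M, hθ, hθ1, hθ2, hθ3, hθ4⟩ := exists_truncated_exp
  obtain ⟨A, hA⟩ := hf.bddSmooth.exists_bound
  obtain ⟨A', hA'⟩ := hf.exists_gradH_bound μ
  have hA0 : 0 ≤ A := (abs_nonneg _).trans (hA 0)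
  have hA'0 : 0 ≤ A' := (norm_nonneg _).trans (hA' 0)
  have hfc := hf.contDiff.continuous
  set h := toH μ l with hh
  have hgc : Continuous fun x => inner ℝ (gradH μ f x) h :=
    (continuous_gradH μ hf.contDiff).inner continuous_const
  have hΨ : MemLp (fun x => inner ℝ (Ψ x) h) (ENNReal.ofReal s') μ :=
    (hlogw.2.1.inner_const h).mono_exponent (ENNReal.ofReal_le_ofReal ht)
  have hl : MemLp l (ENNReal.ofReal s') μ := memLp_dual μ l ENNReal.ofReal_ne_top
  have i1 : Integrable (fun x => |w x| * |l x|) μ := (hw.integrable_mul hl).abs.congr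
    (ae_of_all _ fun x => abs_mul _ _)
  have i2 : Integrable (fun x => |w x| * |inner ℝ (Ψ x) h|) μ := (hw.integrable_mul hΨ).abs.congr
    (ae_of_all _ fun x => abs_mul _ _)
  have hlm : AEStronglyMeasurable (fun x => Real.log (w x)) μ := hlogw.1.1
  have key : ∀ k, _ := fun k => integral_inner_gradH_mul_comp μ hcentered ht1 hlogw hf (hθ k) l
  have l1 : Tendsto (fun k => ∫ x, inner ℝ (gradH μ f x) h * θ k (Real.log (w x)) ∂μ) atTop
      (𝓝 (∫ x, w x * inner ℝ (gradH μ f x) h ∂μ)) := by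
    refine tendsto_integral_of_dominated_convergence (fun x => A' * ‖h‖ * |w x|)
      (fun k => hgc.aestronglyMeasurable.mul
        ((hθ k).1.continuous.comp_aestronglyMeasurable hlm))
      ((hw.integrable hs1).abs.const_mul _) (fun k => ?_) ?_
    · filter_upwards [hwpos] with x hx
      rw [Real.norm_eq_abs, abs_mul]
      refine mul_le_mul ((abs_real_inner_le_norm _ _).trans
        (mul_le_mul_of_nonneg_right (hA' x) (norm_nonneg _))) ?_ (abs_nonneg _) (by positivity)
      refine (hθ1 k _).trans ?_
      rw [Real.exp_log hx]
      exact le_abs_self _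
    · filter_upwards [hwpos] with x hx
      have h1 := (hθ3 (Real.log (w x))).const_mul (inner ℝ (gradH μ f x) h)
      rwa [Real.exp_log hx, mul_comm _ (w x)] at h1
  have l2 : Tendsto (fun k => ∫ x, (f x * l x * θ k (Real.log (w x))
      - f x * inner ℝ (Ψ x) h * deriv (θ k) (Real.log (w x))) ∂μ) atTop
      (𝓝 (∫ x, w x * (f x * logDeriv μ Ψ l x) ∂μ)) := by
    refine tendsto_integral_of_dominated_convergence
      (fun x => A * (|w x| * |l x|) + A * M * (|w x| * |inner ℝ (Ψ x) h|)) (fun k => ?_)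
      ((i1.const_mul A).add (i2.const_mul (A * M))) (fun k => ?_) ?_
    · refine AEStronglyMeasurable.sub ?_ ?_
      · exact (hfc.aestronglyMeasurable.mul l.continuous.aestronglyMeasurable).mul
          ((hθ k).1.continuous.comp_aestronglyMeasurable hlm)
      · exact (hfc.aestronglyMeasurable.mul hΨ.1).mul
          (((hθ k).1.continuous_deriv (mod_cast le_top)).comp_aestronglyMeasurable hlm)
    · filter_upwards [hwpos] with x hx
      have e1 : |θ k (Real.log (w x))| ≤ |w x| := by
        refine (hθ1 k _).trans ?_
        rw [Real.exp_log hx]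
        exact le_abs_self _
      have e2 : |deriv (θ k) (Real.log (w x))| ≤ M * |w x| := by
        refine (hθ2 k _).trans ?_
        rw [Real.exp_log hx, abs_of_pos hx]
      rw [Real.norm_eq_abs]
      refine (abs_sub _ _).trans (add_le_add ?_ ?_)
      · rw [abs_mul, abs_mul]
        calc |f x| * |l x| * |θ k (Real.log (w x))| ≤ A * |l x| * |w x| := by
              gcongr
              exact hA x
          _ = _ := by ring
      · rw [abs_mul, abs_mul]
        calc |f x| * |inner ℝ (Ψ x) h| * |deriv (θ k) (Real.log (w x))|
            ≤ A * |inner ℝ (Ψ x) h| * (M * |w x|) := by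
              gcongr
              exact hA x
          _ = _ := by ring
    · filter_upwards [hwpos] with x hx
      have h1 := (hθ3 (Real.log (w x))).const_mul (f x * l x)
      have h2 := (hθ4 (Real.log (w x))).const_mul (f x * inner ℝ (Ψ x) h)
      rw [Real.exp_log hx] at h1 h2
      have h3 := h1.sub h2
      have e : w x * (f x * logDeriv μ Ψ l x) = f x * l x * w x - f x * inner ℝ (Ψ x) h * w x := by
        rw [logDeriv]
        ring
      rwa [e]
  exact tendsto_nhds_unique l1 (l2.congr fun k => (key k).symm)

end Gaussian

/-! ### Functions determined by their integrals against test functions -/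

section Separation

variable {X : Type*} [NormedAddCommGroup X] [NormedSpace ℝ X] [CompleteSpace X]
  [SecondCountableTopology X] [MeasurableSpace X] [BorelSpace X]

/-- The finite measures u⁺m and u⁻m have the same characteristic functional, since cos ∘ l and sin ∘
l are cylindrical. They are therefore equal, and so are the densities u⁺ and u⁻. -/
theorem ae_eq_zero_of_integral_mul_cylindrical {m : Measure X} [IsFiniteMeasure m] {u : X → ℝ}
    (hu : Integrable u m)
    (h : ∀ g : X → ℝ, IsSmoothCylindrical g → ∫ x, u x * g x ∂m = 0) : u =ᵐ[m] 0 := by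
  have hm1 : AEMeasurable (fun x => ENNReal.ofReal (u x)) m := hu.1.aemeasurable.ennreal_ofReal
  have hm2 : AEMeasurable (fun x => ENNReal.ofReal (-u x)) m :=
    hu.1.aemeasurable.neg.ennreal_ofReal
  have f1 : IsFiniteMeasure (m.withDensity fun x => ENNReal.ofReal (u x)) :=
    isFiniteMeasure_withDensity_ofReal hu.2
  have f2 : IsFiniteMeasure (m.withDensity fun x => ENNReal.ofReal (-u x)) :=
    isFiniteMeasure_withDensity_ofReal hu.neg.2
  have heq : m.withDensity (fun x => ENNReal.ofReal (u x))
      = m.withDensity (fun x => ENNReal.ofReal (-u x)) := by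
    refine Measure.ext_of_charFunDual (funext fun l => ?_)
    rw [charFunDual_apply, charFunDual_apply,
      integral_withDensity_eq_integral_toReal_smul₀ hm1 (ae_of_all _ fun x => ENNReal.ofReal_lt_top),
      integral_withDensity_eq_integral_toReal_smul₀ hm2 (ae_of_all _ fun x => ENNReal.ofReal_lt_top),
      ← sub_eq_zero]
    have hc : Continuous fun x => Complex.exp (l x * Complex.I) := by fun_prop
    have hb : ∀ x, ‖Complex.exp (l x * Complex.I)‖ ≤ 1 := fun x =>
      (Complex.norm_exp_ofReal_mul_I _).le
    have hi : ∀ v : X → ℝ, Integrable v m →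
        Integrable (fun x => (ENNReal.ofReal (v x)).toReal • Complex.exp (l x * Complex.I)) m := by
      intro v hv
      refine Integrable.mono' hv.abs ?_ (ae_of_all _ fun x => ?_)
      · exact (hv.1.aemeasurable.ennreal_ofReal.ennreal_toReal.aestronglyMeasurable).smul
          hc.aestronglyMeasurable
      · rw [norm_smul]
        refine (mul_le_of_le_one_right (norm_nonneg _) (hb x)).trans ?_
        rw [ENNReal.toReal_ofReal', Real.norm_eq_abs, abs_of_nonneg (le_max_right _ _)]
        exact max_le (le_abs_self _) (abs_nonneg _)
    rw [← integral_sub (hi u hu) (hi (fun x => -u x) hu.neg)]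
    have hcos := h _ (isSmoothCylindrical_comp_dual bddSmooth_cos l)
    have hsin := h _ (isSmoothCylindrical_comp_dual bddSmooth_sin l)
    have e : ∀ x, (ENNReal.ofReal (u x)).toReal • Complex.exp (l x * Complex.I)
        - (ENNReal.ofReal (-u x)).toReal • Complex.exp (l x * Complex.I)
        = ((u x * Real.cos (l x) : ℝ) : ℂ) + ((u x * Real.sin (l x) : ℝ) : ℂ) * Complex.I := by
      intro x
      have e1 : (ENNReal.ofReal (u x)).toReal - (ENNReal.ofReal (-u x)).toReal = u x := by
        rw [ENNReal.toReal_ofReal', ENNReal.toReal_ofReal']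
        exact max_zero_sub_max_neg_zero_eq_self _
      rw [← sub_smul, e1, Complex.exp_mul_I, Complex.real_smul]
      push_cast
      ring
    simp only [e]
    rw [integral_add, integral_mul_const, integral_complex_ofReal, integral_complex_ofReal, hcos, hsin]
    · simp
    · exact (hu.mul_bdd (c := 1) (by fun_prop) (ae_of_all _ fun x => Real.abs_cos_le_one _)).ofReal
    · exact ((hu.mul_bdd (c := 1) (by fun_prop)
        (ae_of_all _ fun x => Real.abs_sin_le_one _)).ofReal).mul_const _
  have h0 := (withDensity_eq_iff hm1 hm2 ?_).1 heq
  · filter_upwards [h0] with x hx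
    rcases le_total 0 (u x) with h1 | h1
    · rw [ENNReal.ofReal_of_nonpos (neg_nonpos.2 h1), ENNReal.ofReal_eq_zero] at hx
      exact le_antisymm hx h1
    · rw [ENNReal.ofReal_of_nonpos h1, eq_comm, ENNReal.ofReal_eq_zero] at hx
      simp only [Pi.zero_apply]
      linarith
  · have := hu.2
    rw [hasFiniteIntegral_iff_enorm] at this
    exact ((lintegral_mono fun x => Real.ofReal_le_enorm _).trans_lt this).ne

/-- The exceptional null set depends on the vector k, and S may be uncountable. Almost sure
separability of the range of Φ is what allows a single null set. -/
theorem ae_eq_zero_of_forall_inner_dense {Ω G : Type*} [MeasurableSpace Ω] {m : Measure Ω}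
    [NormedAddCommGroup G] [InnerProductSpace ℝ G] [CompleteSpace G] {Φ : Ω → G}
    (hΦ : AEStronglyMeasurable Φ m) {S : Set G} (hS : (Submodule.span ℝ S)ᗮ = ⊥)
    (h : ∀ k ∈ S, ∀ᵐ x ∂m, inner ℝ (Φ x) k = 0) : Φ =ᵐ[m] 0 := by
  have hspan : ∀ k ∈ Submodule.span ℝ S, ∀ᵐ x ∂m, inner ℝ (Φ x) k = 0 := by
    intro k hk
    induction hk using Submodule.span_induction with
    | mem k hk => exact h k hk
    | zero => simp
    | add a b _ _ ha hb =>
      filter_upwards [ha, hb] with x h1 h2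
      rw [inner_add_right, h1, h2, add_zero]
    | smul c a _ ha =>
      filter_upwards [ha] with x h1
      rw [inner_smul_right, h1, mul_zero]
  have hall : ∀ k : G, ∀ᵐ x ∂m, inner ℝ (Φ x) k = 0 := by
    intro k
    have hk : k ∈ closure (Submodule.span ℝ S : Set G) := by
      have h1 := (Submodule.topologicalClosure_eq_top_iff (K := Submodule.span ℝ S)).2 hS
      have h2 : k ∈ (Submodule.span ℝ S).topologicalClosure := by rw [h1]; trivial
      exact h2
    obtain ⟨a, ha, hak⟩ := mem_closure_iff_seq_limit.1 hk
    filter_upwards [ae_all_iff.2 fun n => hspan (a n) (ha n)] with x hx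
    have h1 : Tendsto (fun n => inner ℝ (Φ x) (a n)) atTop (𝓝 (inner ℝ (Φ x) k)) :=
      tendsto_const_nhds.inner hak
    simp only [hx] at h1
    exact (tendsto_nhds_unique h1 tendsto_const_nhds)
  obtain ⟨t, ht, hmem⟩ := hΦ.isSeparable_ae_range
  refine ae_eq_zero_of_forall_dual_of_isSeparable ℝ ht (fun f => ?_) hmem
  filter_upwards [hall ((InnerProductSpace.toDual ℝ G).symm f)] with x hx
  rw [real_inner_comm, InnerProductSpace.toDual_symm_apply] at hx
  exact hx

end Separation

end WGauss

namespace WGauss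

/-! ### Closability -/

theorem tendsto_eLpNorm_clm_comp {X E E' : Type*} [MeasurableSpace X] {m : Measure X} {p : ℝ≥0∞}
    [NormedAddCommGroup E] [NormedSpace ℝ E] [NormedAddCommGroup E'] [NormedSpace ℝ E']
    (S : E →L[ℝ] E') {u : ℕ → X → E} {F : X → E}
    (h : Tendsto (fun n => eLpNorm (u n - F) p m) atTop (𝓝 0)) :
    Tendsto (fun n => eLpNorm ((fun x => S (u n x)) - fun x => S (F x)) p m) atTop (𝓝 0) := by
  have h0 : Tendsto (fun n => ENNReal.ofReal ‖S‖ * eLpNorm (u n - F) p m) atTop (𝓝 0) := by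
    have := ENNReal.Tendsto.const_mul (a := ENNReal.ofReal ‖S‖) h (Or.inr ENNReal.ofReal_ne_top)
    rwa [mul_zero] at this
  refine tendsto_of_tendsto_of_tendsto_of_le_of_le tendsto_const_nhds h0 (fun _ => zero_le)
    fun n => ?_
  refine eLpNorm_le_mul_eLpNorm_of_ae_le_mul (ae_of_all _ fun x => ?_) p
  simp only [Pi.sub_apply, ← map_sub]
  exact S.le_opNorm _

section Closability

variable {X : Type*} [NormedAddCommGroup X] [NormedSpace ℝ X] [CompleteSpace X]
  [SecondCountableTopology X] [MeasurableSpace X] [BorelSpace X]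
  (μ : Measure X) [IsGaussian μ]

/-- Integration by parts for a component of the gradient of a Sobolev function. -/
theorem HasGrad.integral_component {ν : Measure X} [IsFiniteMeasure ν] {p p' : ℝ≥0∞}
    [ENNReal.HolderConjugate p p'] {l : StrongDual ℝ X} {β : X → ℝ} (hβ : MemLp β p' ν)
    (hibp : ∀ f : X → ℝ, IsSmoothCylindrical f →
      ∫ x, inner ℝ (gradH μ f x) (toH μ l) ∂ν = ∫ x, f x * β x ∂ν)
    {E G : Type*} [NormedAddCommGroup E] [NormedSpace ℝ E] [NormedAddCommGroup G]
    [NormedSpace ℝ G] {T : Submodule ℝ (X → E)} {D : T →ₗ[ℝ] (X → G)}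
    (P : E →L[ℝ] ℝ) (Q : G →L[ℝ] ℝ)
    (hPQ : ∀ u : T, IsSmoothCylindrical (fun x => P ((u : X → E) x)) ∧
      ∀ x, Q (D u x) = inner ℝ (gradH μ (fun y => P ((u : X → E) y)) x) (toH μ l))
    {F : X → E} {Φ : X → G} (h : HasGrad D ν p F Φ) {g : X → ℝ} (hg : IsSmoothCylindrical g) :
    ∫ x, Q (Φ x) * g x ∂ν
      = ∫ x, P (F x) * (g x * β x - inner ℝ (gradH μ g x) (toH μ l)) ∂ν := by
  obtain ⟨hF, hΦ, u, hu, h3, h4⟩ := h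
  have hg1 : MemLp g p' ν := hg.memLp ν p'
  have hg2 : MemLp (fun x => g x * β x - inner ℝ (gradH μ g x) (toH μ l)) p' ν := by
    refine MemLp.sub ?_ ((hg.memLp_gradH μ ν p').inner_const _)
    exact hβ.mul (hg.memLp ν ⊤)
  have l1 := tendsto_integral_mul (fun n => (hu n).2.continuousLinearMap_comp Q)
    (hΦ.continuousLinearMap_comp Q) hg1 (tendsto_eLpNorm_clm_comp Q h4)
  have l2 := tendsto_integral_mul (fun n => (hu n).1.continuousLinearMap_comp P)
    (hF.continuousLinearMap_comp P) hg2 (tendsto_eLpNorm_clm_comp P h3)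
  refine tendsto_nhds_unique l1 (l2.congr fun n => ?_)
  -- For the approximants the identity is `hibp` applied to the product P(u n) · g, expanded by the
  -- Leibniz rule.
  obtain ⟨hc, hd⟩ := hPQ (u n)
  have e := hibp _ (hc.mul hg)
  simp only [gradH_mul μ hc.contDiff hg.contDiff, inner_add_left, real_inner_smul_left,
    ← hd] at e
  have i1 : Integrable (fun x => P ((u n : X → E) x) * inner ℝ (gradH μ g x) (toH μ l)) ν :=
    ((hu n).1.continuousLinearMap_comp P).integrable_mul
      ((hg.memLp_gradH μ ν p').inner_const (toH μ l))
  have i2 : Integrable (fun x => g x * Q (D (u n) x)) ν :=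
    (((hu n).2.continuousLinearMap_comp Q).integrable_mul hg1).congr
      (ae_of_all _ fun x => mul_comm _ _)
  have i3 : Integrable (fun x => P ((u n : X → E) x) * g x * β x) ν :=
    (((hu n).1.continuousLinearMap_comp P).integrable_mul
      (hβ.mul (hg.memLp ν ⊤) (r := p'))).congr (ae_of_all _ fun x => (mul_assoc _ _ _).symm)
  rw [integral_add i1 i2] at e
  have e2 : ∀ x, P ((u n : X → E) x) * (g x * β x - inner ℝ (gradH μ g x) (toH μ l))
      = P ((u n : X → E) x) * g x * β x
        - P ((u n : X → E) x) * inner ℝ (gradH μ g x) (toH μ l) := fun x => by ring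
  simp only [e2]
  rw [integral_sub i3 i1, ← e, add_sub_cancel_left]
  exact integral_congr_ae (ae_of_all _ fun x => mul_comm _ _)

/-- The right-hand side of `HasGrad.integral_component` involves F but not its gradient, so two
gradients of F have the same integrals against test functions. The functionals P and Q allow real
and H-valued F to be treated at once. -/
theorem HasGrad.component_ae_eq {ν : Measure X} [IsFiniteMeasure ν] {p p' : ℝ≥0∞}
    [ENNReal.HolderConjugate p p'] {l : StrongDual ℝ X} {β : X → ℝ} (hβ : MemLp β p' ν)
    (hibp : ∀ f : X → ℝ, IsSmoothCylindrical f →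
      ∫ x, inner ℝ (gradH μ f x) (toH μ l) ∂ν = ∫ x, f x * β x ∂ν)
    {E G : Type*} [NormedAddCommGroup E] [NormedSpace ℝ E] [NormedAddCommGroup G]
    [NormedSpace ℝ G] {T : Submodule ℝ (X → E)} {D : T →ₗ[ℝ] (X → G)}
    (P : E →L[ℝ] ℝ) (Q : G →L[ℝ] ℝ)
    (hPQ : ∀ u : T, IsSmoothCylindrical (fun x => P ((u : X → E) x)) ∧
      ∀ x, Q (D u x) = inner ℝ (gradH μ (fun y => P ((u : X → E) y)) x) (toH μ l))
    {F : X → E} {Φ Φ' : X → G} (h : HasGrad D ν p F Φ) (h' : HasGrad D ν p F Φ') :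
    ∀ᵐ x ∂ν, Q (Φ x - Φ' x) = 0 := by
  have hp1 : 1 ≤ p := ENNReal.HolderConjugate.one_le p p'
  have hm : MemLp (fun x => Q (Φ x - Φ' x)) p ν :=
    (h.2.1.sub h'.2.1).continuousLinearMap_comp Q
  refine ae_eq_zero_of_integral_mul_cylindrical (hm.integrable hp1) fun g hg => ?_
  have e1 := h.integral_component μ hβ hibp P Q hPQ hg
  have e2 := h'.integral_component μ hβ hibp P Q hPQ hg
  have hg1 : MemLp g p' ν := hg.memLp ν p'
  simp only [map_sub, sub_mul]
  have i1 : Integrable (fun x => Q (Φ x) * g x) ν :=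
    (h.2.1.continuousLinearMap_comp Q).integrable_mul hg1
  have i2 : Integrable (fun x => Q (Φ' x) * g x) ν :=
    (h'.2.1.continuousLinearMap_comp Q).integrable_mul hg1
  rw [integral_sub i1 i2, e1, e2, sub_self]

/-- By construction H is the closure of the vectors R_μ l, so a vector orthogonal to all of them is
orthogonal to itself. -/
theorem eq_zero_of_forall_inner_toH {g : CM μ} (h : ∀ l, inner ℝ (toH μ l) g = 0) : g = 0 := by
  have hg : hat μ g ∈ closure (Set.range (StrongDual.toLp (𝕜 := ℝ) μ 2)) := by
    have := Subtype.prop (show dualClosure μ from g)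
    exact this
  obtain ⟨a, ha, hlim⟩ := mem_closure_iff_seq_limit.1 hg
  have h1 : Tendsto (fun n => inner ℝ (a n) (hat μ g)) atTop
      (𝓝 (inner ℝ (hat μ g) (hat μ g))) :=
    Tendsto.inner hlim tendsto_const_nhds
  have h2 : ∀ n, inner ℝ (a n) (hat μ g) = 0 := fun n => by
    obtain ⟨l, hl⟩ := ha n
    rw [← hl]
    exact h l
  simp only [h2] at h1
  have h3 := tendsto_nhds_unique tendsto_const_nhds h1
  rw [(hat μ).inner_map_map] at h3
  exact inner_self_eq_zero.1 h3.symm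

theorem closable_gradOp {ν : Measure X} [IsFiniteMeasure ν] {p p' : ℝ≥0∞}
    [ENNReal.HolderConjugate p p'] {β : StrongDual ℝ X → X → ℝ} (hβ : ∀ l, MemLp (β l) p' ν)
    (hibp : ∀ l, ∀ f : X → ℝ, IsSmoothCylindrical f →
      ∫ x, inner ℝ (gradH μ f x) (toH μ l) ∂ν = ∫ x, f x * β l x ∂ν) :
    Closable (gradOp μ) ν p := by
  intro F Φ Φ' h h'
  have h0 : (fun x => Φ x - Φ' x) =ᵐ[ν] 0 := by
    refine ae_eq_zero_of_forall_inner_dense (S := Set.range (toH μ)) (h.2.1.1.sub h'.2.1.1) ?_ ?_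
    · rw [Submodule.eq_bot_iff]
      intro g hg
      refine eq_zero_of_forall_inner_toH μ fun l => ?_
      exact hg _ (Submodule.subset_span ⟨l, rfl⟩)
    · rintro _ ⟨l, rfl⟩
      have := HasGrad.component_ae_eq μ (hβ l) (hibp l) (ContinuousLinearMap.id ℝ ℝ)
        (innerSL ℝ (toH μ l)) (fun u => ⟨isSmoothCylindrical_of_mem u.2, fun x => ?_⟩) h h'
      · filter_upwards [this] with x hx
        rw [real_inner_comm]
        exact hx
      · rw [innerSL_apply_apply, real_inner_comm]
        rfl
  filter_upwards [h0] with x hx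
  exact sub_eq_zero.1 hx

/-! ### Rank one test operators and closability for vector-valued functions -/

section HilbertValued

variable {ι : Type*} (e : HilbertBasis ι ℝ (CM μ))
  {E : Type*} [NormedAddCommGroup E] [InnerProductSpace ℝ E]

/-- The rank one operator `g ↦ ⟪h, g⟫ k`. -/
noncomputable def rankOne (h : CM μ) (k : E) : HS μ e E :=
  ⟨fun i => e.repr h i • k, by
    have h1 : Memℓp (fun i => e.repr h i) 2 := lp.memℓp (e.repr h)
    refine memℓp_gen ?_
    have h2 := (h1.summable (by norm_num)).mul_right (‖k‖ ^ (2 : ℝ≥0∞).toReal)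
    refine h2.congr fun i => ?_
    rw [norm_smul, Real.mul_rpow (norm_nonneg _) (norm_nonneg _)]⟩

theorem inner_rankOne (A : HS μ e E) (h : CM μ) (k : E) :
    inner ℝ A (rankOne μ e h k) = ∑' i, e.repr h i * inner ℝ (A i) k := by
  rw [lp.inner_eq_tsum]
  refine tsum_congr fun i => ?_
  exact inner_smul_right _ _ _

/-- Expanding h in the basis gives ∑ᵢ ⟨eᵢ, h⟩⟨A eᵢ, k⟩ = ⟨A h, k⟩: pairing with rank one operators
reads off the derivative of ⟨F, k⟩ along h. -/
theorem inner_restrictHS_rankOne (A : X →L[ℝ] E) (h : CM μ) (k : E) :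
    inner ℝ (restrictHS μ e A) (rankOne μ e h k) = inner ℝ (A (incl μ h)) k := by
  rw [inner_rankOne]
  have h1 := (e.hasSum_repr h).mapL ((innerSL ℝ k).comp (A.comp (incl μ)))
  rw [← real_inner_comm]
  refine Eq.trans (tsum_congr fun i => ?_) h1.tsum_eq
  simp only [map_smul, smul_eq_mul, ContinuousLinearMap.comp_apply, innerSL_apply_apply]
  rw [real_inner_comm]
  rfl

/-- For fixed k the sequence ⟨A eᵢ, k⟩ is square summable, hence the coordinates of a vector of H,
namely A*k. It is orthogonal to every R_μ l, so it vanishes. -/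
theorem eq_zero_of_forall_inner_rankOne {A : HS μ e E}
    (hA : ∀ l k, inner ℝ A (rankOne μ e (toH μ l) k) = 0) : A = 0 := by
  refine lp.ext (funext fun i => ?_)
  refine ext_inner_right ℝ fun k => ?_
  have hm : Memℓp (fun i => inner ℝ (A i) k) 2 := by
    refine memℓp_gen ?_
    have h2 := ((lp.memℓp A).summable (by norm_num)).mul_right (‖k‖ ^ (2 : ℝ≥0∞).toReal)
    refine Summable.of_nonneg_of_le (fun i => by positivity) (fun i => ?_) h2
    rw [← Real.mul_rpow (norm_nonneg _) (norm_nonneg _)]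
    exact Real.rpow_le_rpow (norm_nonneg _) (norm_inner_le_norm _ _) (by norm_num)
  set c : lp (fun _ : ι => ℝ) 2 := ⟨_, hm⟩ with hc
  have h0 : e.repr.symm c = 0 := by
    refine eq_zero_of_forall_inner_toH μ fun l => ?_
    rw [← e.repr.inner_map_map, LinearIsometryEquiv.apply_symm_apply, lp.inner_eq_tsum,
      ← hA l k, inner_rankOne]
    refine tsum_congr fun i => ?_
    change inner ℝ (A i) k * _ = _
    exact mul_comm _ _
  have hc0 : c = 0 := by simpa using h0
  have := congrArg (fun v : lp (fun _ : ι => ℝ) 2 => v i) hc0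
  simpa [hc] using this

theorem closable_gradOpV [CompleteSpace E] {ν : Measure X} [IsFiniteMeasure ν] {p p' : ℝ≥0∞}
    [ENNReal.HolderConjugate p p'] {β : StrongDual ℝ X → X → ℝ} (hβ : ∀ l, MemLp (β l) p' ν)
    (hibp : ∀ l, ∀ f : X → ℝ, IsSmoothCylindrical f →
      ∫ x, inner ℝ (gradH μ f x) (toH μ l) ∂ν = ∫ x, f x * β l x ∂ν) :
    Closable (gradOpV μ e E) ν p := by
  intro F Φ Φ' h h'
  have h0 : (fun x => Φ x - Φ' x) =ᵐ[ν] 0 := by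
    refine ae_eq_zero_of_forall_inner_dense
      (S := {A | ∃ l k, A = rankOne μ e (toH μ l) k}) (h.2.1.1.sub h'.2.1.1) ?_ ?_
    · rw [Submodule.eq_bot_iff]
      intro A hA
      refine eq_zero_of_forall_inner_rankOne μ e fun l k => ?_
      rw [real_inner_comm]
      exact hA _ (Submodule.subset_span ⟨l, k, rfl⟩)
    · rintro _ ⟨l, k, rfl⟩
      have := HasGrad.component_ae_eq μ (hβ l) (hibp l) (innerSL ℝ k)
        (innerSL ℝ (rankOne μ e (toH μ l) k)) (fun u => ⟨?_, fun x => ?_⟩) h h'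
      · filter_upwards [this] with x hx
        rw [real_inner_comm]
        exact hx
      · exact isSmoothCylindrical_of_mem (comp_mem_cylindrical (innerSL ℝ k) u.2)
      · rw [innerSL_apply_apply, real_inner_comm]
        have hd := (contDiff_of_mem_cylindrical u.2).differentiable (by simp) x
        have h1 := inner_restrictHS_rankOne μ e (fderiv ℝ (u : X → E) x) (toH μ l) k
        refine h1.trans ?_
        have h2 : fderiv ℝ (fun y => innerSL ℝ k ((u : X → E) y)) x
            = (innerSL ℝ k).comp (fderiv ℝ (u : X → E) x) :=
          ((innerSL ℝ k).hasFDerivAt.comp x hd.hasFDerivAt).fderiv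
        rw [inner_gradH, h2, real_inner_comm]
        rfl
  filter_upwards [h0] with x hx
  exact sub_eq_zero.1 hx

end HilbertValued

end Closability

end WGauss

namespace WGauss

/-! ### Uniform convexity -/

section Scalar

/-- Quantitative strict convexity of `‖·‖ᵖ` in an inner product space, for vectors of norms `1` and
`t ≤ 1` at distance at least `ε`. -/
theorem exists_midpoint_gap {p : ℝ} (hp : 1 < p) {ε : ℝ} (hε : 0 < ε) :
    ∃ δ > 0, ∀ t d m : ℝ, 0 ≤ t → t ≤ 1 → 0 ≤ m → ε ≤ d → d ≤ 2 → 1 - t ≤ d →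
      m ^ 2 = (1 + t ^ 2) / 2 - d ^ 2 / 4 → m ^ p ≤ (1 + t ^ p) / 2 - δ := by
  have hp0 : 0 < p := by linarith
  -- The admissible pairs (t, d) form a compact set, and the gap Γ is continuous and positive on it,
  -- so its minimum serves as δ. The truncation `max 0` makes Γ continuous on the whole plane.
  set S : Set (ℝ × ℝ) := (Set.Icc 0 1 ×ˢ Set.Icc ε 2) ∩ {z | 1 - z.1 ≤ z.2} with hS
  have hSc : IsCompact S := (isCompact_Icc.prod isCompact_Icc).inter_right
    (isClosed_le (by fun_prop) (by fun_prop))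
  set Γ : ℝ × ℝ → ℝ := fun z => (1 + z.1 ^ p) / 2
    - (max 0 ((1 + z.1 ^ 2) / 2 - z.2 ^ 2 / 4)) ^ (p / 2) with hΓ
  have hΓc : Continuous Γ := by
    have h1 : Continuous fun z : ℝ × ℝ => z.1 ^ p :=
      continuous_fst.rpow_const fun _ => Or.inr hp0.le
    have h2 : Continuous fun z : ℝ × ℝ =>
        (max 0 ((1 + z.1 ^ 2) / 2 - z.2 ^ 2 / 4)) ^ (p / 2) :=
      (by fun_prop : Continuous fun z : ℝ × ℝ =>
        max 0 ((1 + z.1 ^ 2) / 2 - z.2 ^ 2 / 4)).rpow_const fun _ => Or.inr (by positivity)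
    fun_prop
  have hpos : ∀ z ∈ S, 0 < Γ z := by
    rintro ⟨t, d⟩ ⟨⟨⟨ht0, ht1⟩, hd1, hd2⟩, htd⟩
    simp only [Set.mem_ofPred_eq] at ht0 ht1 hd1 hd2 htd
    simp only [hΓ, sub_pos]
    -- For t < 1 the constraint 1 - t ≤ d bounds m by (1 + t)/2 and strict convexity of the power
    -- gives the gap; for t = 1 the gap comes from d ≥ ε.
    rcases ht1.lt_or_eq with ht1 | rfl
    · have h1 : max 0 ((1 + t ^ 2) / 2 - d ^ 2 / 4) ≤ ((1 + t) / 2) ^ 2 :=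
        max_le (by positivity) (by nlinarith)
      refine (Real.rpow_le_rpow (le_max_left _ _) h1 (by positivity)).trans_lt ?_
      rw [← Real.rpow_natCast, ← Real.rpow_mul (by positivity)]
      have h2 := (strictConvexOn_rpow hp).2 (show (1 : ℝ) ∈ Set.Ici 0 by simp)
        (show t ∈ Set.Ici 0 from ht0) ht1.ne' (show (0 : ℝ) < 1 / 2 by norm_num)
        (show (0 : ℝ) < 1 / 2 by norm_num) (by norm_num)
      simp only [smul_eq_mul, Real.one_rpow] at h2
      have e1 : ((2 : ℕ) : ℝ) * (p / 2) = p := by push_cast; ring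
      have e2 : (1 + t) / 2 = 1 / 2 * 1 + 1 / 2 * t := by ring
      rw [e1, e2]
      linarith
    · have h1 : max 0 ((1 + (1 : ℝ) ^ 2) / 2 - d ^ 2 / 4) < 1 :=
        max_lt one_pos (by nlinarith)
      refine (Real.rpow_lt_one (le_max_left _ _) h1 (by positivity)).trans_le ?_
      simp
  obtain ⟨δ, hδ, hmin⟩ : ∃ δ > 0, ∀ z ∈ S, δ ≤ Γ z := by
    rcases S.eq_empty_or_nonempty with h | h
    · exact ⟨1, one_pos, by simp [h]⟩
    · obtain ⟨z, hz, hmin⟩ := hSc.exists_isMinOn h hΓc.continuousOn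
      exact ⟨Γ z, hpos z hz, fun y hy => hmin hy⟩
  refine ⟨δ, hδ, fun t d m ht0 ht1 hm hd1 hd2 htd hmd => ?_⟩
  have h1 := hmin (t, d) ⟨⟨⟨ht0, ht1⟩, hd1, hd2⟩, htd⟩
  simp only [hΓ] at h1
  rw [← hmd, max_eq_right (by positivity), ← Real.rpow_natCast, ← Real.rpow_mul hm] at h1
  have e1 : ((2 : ℕ) : ℝ) * (p / 2) = p := by push_cast; ring
  rw [e1] at h1
  linarith

/-- A scale invariant form of uniform convexity, in terms of the norms `α`, `β` of two vectors,
the norm `d` of their difference and the norm `m` of their midpoint. -/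
theorem exists_uniformConvexity_const {p : ℝ} (hp : 1 < p) {ε : ℝ} (hε : 0 < ε) :
    ∃ K ≥ 0, ∀ α β d m : ℝ, 0 ≤ α → 0 ≤ β → 0 ≤ d → 0 ≤ m → |α - β| ≤ d → d ≤ α + β →
      m ^ 2 = (α ^ 2 + β ^ 2) / 2 - d ^ 2 / 4 →
      d ^ p ≤ ε * (α ^ p + β ^ p) + K * ((α ^ p + β ^ p) / 2 - m ^ p) := by
  have hp0 : 0 < p := by linarith
  -- With α the larger norm, d < ε^{1/p} α gives d^p ≤ ε α^p outright. Otherwise scaling by α leads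
  -- to the gap δ α^p, and d ≤ 2α makes K = 2^p/δ sufficient.
  obtain ⟨δ, hδ, H⟩ := exists_midpoint_gap hp (ε := ε ^ (1 / p)) (by positivity)
  have hεp : (ε ^ (1 / p)) ^ p = ε := by
    rw [← Real.rpow_mul hε.le, one_div_mul_cancel hp0.ne', Real.rpow_one]
  refine ⟨2 ^ p / δ, by positivity, ?_⟩
  intro α β d m hα hβ hd hm hαβ hd2 hmd
  wlog hle : β ≤ α generalizing α β
  · have := this β α hβ hα (by rwa [abs_sub_comm]) (by linarith) (by linarith) (by linarith)
    rwa [add_comm (β ^ p)] at this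
  have hmid : m ^ p ≤ (α ^ p + β ^ p) / 2 := by
    have h1 : m ≤ (α + β) / 2 := by
      refine abs_le_of_sq_le_sq' ?_ (by positivity) |>.2
      have := sq_abs (α - β)
      have := abs_nonneg (α - β)
      nlinarith
    have h2 := (convexOn_rpow hp.le).2 (show α ∈ Set.Ici 0 from hα) (show β ∈ Set.Ici 0 from hβ)
      (show (0 : ℝ) ≤ 1 / 2 by norm_num) (show (0 : ℝ) ≤ 1 / 2 by norm_num) (by norm_num)
    simp only [smul_eq_mul] at h2
    have e2 : (α + β) / 2 = 1 / 2 * α + 1 / 2 * β := by ring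
    refine (Real.rpow_le_rpow hm h1 hp0.le).trans ?_
    rw [e2]
    linarith
  have hgap : 0 ≤ (α ^ p + β ^ p) / 2 - m ^ p := by linarith
  have hK0 : 0 ≤ 2 ^ p / δ * ((α ^ p + β ^ p) / 2 - m ^ p) := by positivity
  have hαp : 0 ≤ α ^ p := by positivity
  have hβp : 0 ≤ β ^ p := by positivity
  rcases hα.eq_or_lt with rfl | hα0
  · have hd0 : d = 0 := by linarith
    rw [hd0, Real.zero_rpow hp0.ne'] at *
    exact add_nonneg (by positivity) hK0
  rcases le_or_gt (ε ^ (1 / p) * α) d with hcase | hcase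
  · have h := H (β / α) (d / α) (m / α) (by positivity) ((div_le_one hα0).2 hle) (by positivity)
      ((le_div_iff₀ hα0).2 hcase) ((div_le_iff₀ hα0).2 (by linarith)) ?_ ?_
    · rw [Real.div_rpow hm hα, Real.div_rpow hβ hα] at h
      have hαp' : 0 < α ^ p := by positivity
      have h3 : m ^ p ≤ (α ^ p + β ^ p) / 2 - δ * α ^ p := by
        have := mul_le_mul_of_nonneg_right h hαp
        rw [div_mul_cancel₀ _ hαp'.ne'] at this
        refine this.trans (le_of_eq ?_)
        field_simp
      have h4 : d ^ p ≤ 2 ^ p * α ^ p := by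
        rw [← Real.mul_rpow (by norm_num) hα]
        exact Real.rpow_le_rpow hd (by linarith) hp0.le
      have h5 : 2 ^ p * α ^ p ≤ 2 ^ p / δ * ((α ^ p + β ^ p) / 2 - m ^ p) := by
        rw [div_mul_eq_mul_div, le_div_iff₀ hδ, mul_assoc]
        refine mul_le_mul_of_nonneg_left ?_ (by positivity)
        linarith
      have h6 : 0 ≤ ε * (α ^ p + β ^ p) := by positivity
      linarith
    · rw [sub_le_iff_le_add, ← add_div, le_div_iff₀ hα0]
      have := le_abs_self (α - β)
      linarith
    · field_simp
      linarith
  · have h1 : d ^ p ≤ ε * α ^ p := by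
      refine (Real.rpow_le_rpow hd hcase.le hp0.le).trans (le_of_eq ?_)
      rw [Real.mul_rpow (by positivity) hα, hεp]
    have h2 : 0 ≤ ε * β ^ p := by positivity
    rw [mul_add]
    linarith

/-- Integrated form of uniform convexity. -/
theorem integral_norm_sub_rpow_le {p ε K : ℝ} (hp : 1 < p)
    (hK : ∀ α β d m : ℝ, 0 ≤ α → 0 ≤ β → 0 ≤ d → 0 ≤ m → |α - β| ≤ d → d ≤ α + β →
      m ^ 2 = (α ^ 2 + β ^ 2) / 2 - d ^ 2 / 4 →
      d ^ p ≤ ε * (α ^ p + β ^ p) + K * ((α ^ p + β ^ p) / 2 - m ^ p))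
    {Ω E : Type*} [MeasurableSpace Ω] {m : Measure Ω} [NormedAddCommGroup E]
    [InnerProductSpace ℝ E] {f g : Ω → E} (hf : MemLp f (ENNReal.ofReal p) m)
    (hg : MemLp g (ENNReal.ofReal p) m) :
    ∫ x, ‖f x - g x‖ ^ p ∂m ≤ ε * (∫ x, ‖f x‖ ^ p ∂m + ∫ x, ‖g x‖ ^ p ∂m)
      + K * ((∫ x, ‖f x‖ ^ p ∂m + ∫ x, ‖g x‖ ^ p ∂m) / 2
        - ∫ x, ‖(1 / 2 : ℝ) • (f x + g x)‖ ^ p ∂m) := by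
  have hp0 : 0 < p := by linarith
  have hi : ∀ {u : Ω → E}, MemLp u (ENNReal.ofReal p) m → Integrable (fun x => ‖u x‖ ^ p) m := by
    intro u hu
    have := hu.integrable_norm_rpow (by simpa using hp0) (by simp)
    rwa [ENNReal.toReal_ofReal hp0.le] at this
  have i1 := hi hf
  have i2 := hi hg
  have i3 := hi (hf.sub hg)
  have i4 : Integrable (fun x => ‖(1 / 2 : ℝ) • (f x + g x)‖ ^ p) m :=
    hi ((hf.add hg).const_smul (1 / 2 : ℝ))
  have hle : ∀ x, ‖f x - g x‖ ^ p ≤ ε * (‖f x‖ ^ p + ‖g x‖ ^ p)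
      + K * ((‖f x‖ ^ p + ‖g x‖ ^ p) / 2 - ‖(1 / 2 : ℝ) • (f x + g x)‖ ^ p) := fun x => by
    refine hK _ _ _ _ (norm_nonneg _) (norm_nonneg _) (norm_nonneg _) (norm_nonneg _)
      (abs_norm_sub_norm_le _ _) (norm_sub_le _ _) ?_
    have h1 := parallelogram_law_with_norm ℝ (f x) (g x)
    rw [norm_smul, Real.norm_eq_abs, abs_of_pos (by norm_num : (0 : ℝ) < 1 / 2)]
    nlinarith
  have i5 : Integrable (fun x => ε * (‖f x‖ ^ p + ‖g x‖ ^ p)) m := (i1.add i2).const_mul ε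
  have i6 : Integrable (fun x => (‖f x‖ ^ p + ‖g x‖ ^ p) / 2) m := (i1.add i2).div_const 2
  have i7 : Integrable (fun x => K * ((‖f x‖ ^ p + ‖g x‖ ^ p) / 2
      - ‖(1 / 2 : ℝ) • (f x + g x)‖ ^ p)) m := (i6.sub i4).const_mul K
  refine (integral_mono i3 (i5.add i7) hle).trans (le_of_eq ?_)
  simp only [Pi.add_apply]
  rw [integral_add i5 i7, integral_const_mul, integral_const_mul, integral_sub i6 i4,
    integral_div, integral_add i1 i2]

end Scalar

/-! ### Compactness from a uniformly convex gauge; Milman–Pettis -/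

section Gauge

variable {V : Type*} [NormedAddCommGroup V] [NormedSpace ℝ V]

/-- A function on a normed space which is uniformly convex on its sublevel sets. -/
def IsUniformlyConvexGauge (N : V → ℝ) : Prop :=
  (∀ v, 0 ≤ N v) ∧ (∀ r, ∃ R, ∀ v, ‖v‖ ≤ r → N v ≤ R) ∧
  ∀ R η : ℝ, 0 < η → ∃ δ > 0, ∀ u v, N u ≤ R → N v ≤ R →
    (N u + N v) / 2 - N ((1 / 2 : ℝ) • (u + v)) ≤ δ → dist u v < η

/-- In a complete space with a uniformly convex gauge, directed families of nonempty bounded closed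
convex sets have a common point. -/
theorem IsUniformlyConvexGauge.exists_forall_mem [CompleteSpace V] {N : V → ℝ}
    (hN : IsUniformlyConvexGauge N) {I : Type*} [Nonempty I] {C : I → Set V}
    (hdir : Directed (· ⊇ ·) C) (hne : ∀ i, (C i).Nonempty) (hcl : ∀ i, IsClosed (C i))
    (hconv : ∀ i, Convex ℝ (C i)) {r : ℝ} (hr : ∀ i, ∀ v ∈ C i, ‖v‖ ≤ r) :
    ∃ x, ∀ i, x ∈ C i := by
  obtain ⟨hN0, hNb, hNu⟩ := hN
  obtain ⟨R, hR⟩ := hNb r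
  have hR' : ∀ i, ∀ v ∈ C i, N v ≤ R := fun i v hv => hR v (hr i v hv)
  have hbb : ∀ i, BddBelow (N '' C i) := fun i => ⟨0, by rintro _ ⟨v, -, rfl⟩; exact hN0 v⟩
  set a : I → ℝ := fun i => sInf (N '' C i) with ha
  have hab : BddAbove (Set.range a) := by
    refine ⟨R, ?_⟩
    rintro _ ⟨i, rfl⟩
    obtain ⟨v, hv⟩ := hne i
    exact (csInf_le (hbb i) ⟨v, hv, rfl⟩).trans (hR' i v hv)
  -- The supremum of the infima of N over the sets C i. The near-minimizers, points of C i with N <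
  -- A + δ, form a directed family; its filter is Cauchy by uniform convexity, and its limit is the
  -- common point.
  set A : ℝ := ⨆ i, a i with hA
  have hle : ∀ i, a i ≤ A := fun i => le_ciSup hab i
  set B : I × {δ : ℝ // 0 < δ} → Set V := fun q => {v | v ∈ C q.1 ∧ N v < A + q.2} with hB
  have hBne : ∀ q, (B q).Nonempty := by
    rintro ⟨i, δ, hδ⟩
    obtain ⟨_, ⟨v, hv, rfl⟩, hlt⟩ := exists_lt_of_csInf_lt ((hne i).image N)
      (show sInf (N '' C i) < A + δ from (hle i).trans_lt (by linarith))
    exact ⟨v, hv, hlt⟩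
  have hBdir : Directed (· ≥ ·) fun q => 𝓟 (B q) := by
    rintro ⟨i, δ, hδ⟩ ⟨j, δ', hδ'⟩
    obtain ⟨k, hki, hkj⟩ := hdir i j
    refine ⟨⟨k, min δ δ', lt_min hδ hδ'⟩, ?_, ?_⟩
    · refine principal_mono.2 fun v hv => ⟨hki hv.1, hv.2.trans_le ?_⟩
      exact add_le_add_right (min_le_left _ _) _
    · refine principal_mono.2 fun v hv => ⟨hkj hv.1, hv.2.trans_le ?_⟩
      exact add_le_add_right (min_le_right _ _) _
  have : Nonempty {δ : ℝ // 0 < δ} := ⟨⟨1, one_pos⟩⟩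
  set f : Filter V := ⨅ q, 𝓟 (B q) with hf
  have hBf : ∀ q, B q ∈ f := fun q => mem_iInf_of_mem q (mem_principal_self _)
  have hfne : f.NeBot := iInf_neBot_of_directed' hBdir fun q => principal_neBot_iff.2 (hBne q)
  have hcau : Cauchy f := by
    refine Metric.cauchy_iff.2 ⟨hfne, fun η hη => ?_⟩
    obtain ⟨δ, hδ, hδ'⟩ := hNu R η hη
    -- The midpoint of two points of C i stays in C i, so its gauge is at least a i > A - δ/2, while
    -- both end points have gauge below A + δ/2: the gap is less than δ.
    obtain ⟨i, hi⟩ := exists_lt_of_lt_ciSup (show A - δ / 2 < ⨆ i, a i by linarith)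
    refine ⟨B ⟨i, δ / 2, by positivity⟩, hBf _, fun u hu v hv => ?_⟩
    refine hδ' u v (hR' i u hu.1) (hR' i v hv.1) ?_
    have hmid : (1 / 2 : ℝ) • (u + v) ∈ C i := by
      rw [smul_add]
      exact hconv i hu.1 hv.1 (by norm_num) (by norm_num) (by norm_num)
    have h1 : a i ≤ N ((1 / 2 : ℝ) • (u + v)) := csInf_le (hbb i) ⟨_, hmid, rfl⟩
    have h2 := hu.2
    have h3 := hv.2
    simp only at h2 h3
    linarith
  obtain ⟨x, hx⟩ := CompleteSpace.complete hcau
  refine ⟨x, fun i => ?_⟩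
  refine (hcl i).mem_of_tendsto (f := id) (b := f) hx ?_
  filter_upwards [hBf ⟨i, 1, one_pos⟩] with v hv
  exact hv.1

/-- **Helly's lemma**: an element of the bidual is approximated on finitely many functionals. -/
theorem exists_norm_le_and_forall_abs_sub_le (J : StrongDual ℝ (StrongDual ℝ V))
    (F : Finset (StrongDual ℝ V)) {δ : ℝ} (hδ : 0 < δ) :
    ∃ v : V, ‖v‖ ≤ ‖J‖ ∧ ∀ Λ ∈ F, |Λ v - J Λ| ≤ δ := by
  classical
  set L : V →L[ℝ] (F → ℝ) := ContinuousLinearMap.pi fun Λ => (Λ : StrongDual ℝ V) with hL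
  set y : F → ℝ := fun Λ => J Λ with hy
  set S : Set (F → ℝ) := L '' Metric.closedBall 0 ‖J‖ with hS
  have hSconv : Convex ℝ S := (convex_closedBall _ _).linear_image L.toLinearMap
  have hmem : y ∈ closure S := by
    -- A functional f separating y from L(ball) pulls back to g in the dual of V, bounded by u on
    -- the ball of radius ‖J‖. Hence J g ≤ ‖J‖‖g‖ ≤ u, whereas J g = f y > u.
    by_contra hcon
    obtain ⟨f, u, hf1, hf2⟩ := geometric_hahn_banach_closed_point hSconv.closure isClosed_closure
      hcon
    set g : StrongDual ℝ V := ∑ Λ : F, f (Pi.single Λ 1) • (Λ : StrongDual ℝ V) with hg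
    have hfx : ∀ z : F → ℝ, f z = ∑ Λ : F, f (Pi.single Λ 1) * z Λ := fun z => by
      conv_lhs => rw [← Finset.univ_sum_single z]
      rw [map_sum]
      refine Finset.sum_congr rfl fun Λ _ => ?_
      have : (Pi.single Λ (z Λ) : F → ℝ) = z Λ • Pi.single Λ 1 := by
        rw [← Pi.single_smul, smul_eq_mul, mul_one]
      rw [this, map_smul, smul_eq_mul, mul_comm]
    have hgv : ∀ v, g v = f (L v) := fun v => by
      rw [hfx]
      simp [hg, hL]
    have hJg : J g = f y := by
      rw [hfx]
      simp [hg, hy]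
    have hlt : ∀ v : V, ‖v‖ ≤ ‖J‖ → g v < u := fun v hv => by
      rw [hgv]
      exact hf1 _ (subset_closure ⟨v, by simpa using hv, rfl⟩)
    have hu0 : 0 < u := by simpa using hlt 0 (by rw [norm_zero]; exact norm_nonneg J)
    -- A ball of radius zero gives no bound on ‖g‖, so J = 0 is excluded separately, using u > 0.
    rcases (norm_nonneg J).eq_or_lt with hJ0 | hJ0
    · have h1 : ‖J g‖ ≤ 0 := (J.le_opNorm g).trans (by rw [← hJ0, zero_mul])
      rw [← hJg, norm_le_zero_iff.1 h1] at hf2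
      linarith
    have hgn : ‖g‖ ≤ u / ‖J‖ := by
      refine g.opNorm_le_bound (by positivity) fun v => ?_
      rcases eq_or_ne v 0 with rfl | hv
      · simp
      have hvn : 0 < ‖v‖ := norm_pos_iff.2 hv
      have hsc : ‖(‖J‖ / ‖v‖) • v‖ ≤ ‖J‖ := by
        rw [norm_smul, Real.norm_eq_abs, abs_of_nonneg (by positivity),
          div_mul_cancel₀ _ hvn.ne']
      have h1 := hlt _ hsc
      have h2 := hlt (-((‖J‖ / ‖v‖) • v)) (by rwa [norm_neg])
      rw [map_neg] at h2
      rw [map_smul, smul_eq_mul] at h1 h2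
      have h3 : ‖J‖ / ‖v‖ * |g v| ≤ u := by
        rw [← abs_of_pos (by positivity : 0 < ‖J‖ / ‖v‖), ← abs_mul]
        exact abs_le.2 ⟨by linarith, h1.le⟩
      rw [Real.norm_eq_abs, div_mul_eq_mul_div, le_div_iff₀ hJ0]
      rw [div_mul_eq_mul_div, div_le_iff₀ hvn] at h3
      linarith
    have h5 : J g ≤ u := by
      refine (le_abs_self _).trans ((J.le_opNorm g).trans ?_)
      calc ‖J‖ * ‖g‖ ≤ ‖J‖ * (u / ‖J‖) := by gcongr
        _ = u := by field_simp
    rw [hJg] at h5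
    linarith
  obtain ⟨_, ⟨v, hv, rfl⟩, hdist⟩ := Metric.mem_closure_iff.1 hmem δ hδ
  refine ⟨v, by simpa using hv, fun Λ hΛ => ?_⟩
  have h1 := (dist_le_pi_dist y (L v) ⟨Λ, hΛ⟩).trans hdist.le
  rw [Real.dist_eq, abs_sub_comm] at h1
  exact h1

/-- **Milman–Pettis theorem**, for a space with a uniformly convex gauge. -/
theorem IsUniformlyConvexGauge.isReflexive [CompleteSpace V] {N : V → ℝ}
    (hN : IsUniformlyConvexGauge N) : IsReflexive V := by
  classical
  intro J
  -- Helly's lemma makes these sets nonempty. A point common to all of them satisfies Λ x = J Λ for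
  -- every functional Λ.
  set C : Finset (StrongDual ℝ V) × {δ : ℝ // 0 < δ} → Set V := fun q =>
    {v | ‖v‖ ≤ ‖J‖ ∧ ∀ Λ ∈ q.1, |Λ v - J Λ| ≤ q.2} with hC
  have : Nonempty {δ : ℝ // 0 < δ} := ⟨⟨1, one_pos⟩⟩
  have key : ∃ x, ∀ q, x ∈ C q := by
    refine hN.exists_forall_mem (r := ‖J‖) ?_ ?_ ?_ ?_ fun q v hv => hv.1
    · rintro ⟨F, δ, hδ⟩ ⟨F', δ', hδ'⟩
      refine ⟨⟨F ∪ F', min δ δ', lt_min hδ hδ'⟩, fun v hv => ⟨hv.1, fun Λ hΛ => ?_⟩,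
        fun v hv => ⟨hv.1, fun Λ hΛ => ?_⟩⟩
      · exact (hv.2 Λ (Finset.mem_union_left _ hΛ)).trans (min_le_left _ _)
      · exact (hv.2 Λ (Finset.mem_union_right _ hΛ)).trans (min_le_right _ _)
    · rintro ⟨F, δ, hδ⟩
      exact exists_norm_le_and_forall_abs_sub_le J F hδ
    · rintro ⟨F, δ, hδ⟩
      have h1 : IsClosed {v : V | ‖v‖ ≤ ‖J‖} := isClosed_le continuous_norm continuous_const
      have h2 : IsClosed (⋂ Λ ∈ F, {v : V | |Λ v - J Λ| ≤ δ}) :=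
        isClosed_biInter fun Λ _ => isClosed_le (by fun_prop) continuous_const
      convert h1.inter h2 using 1
      ext v
      simp [hC]
    · rintro ⟨F, δ, hδ⟩ u hu v hv a b ha hb hab
      refine ⟨?_, fun Λ hΛ => ?_⟩
      · have := convex_closedBall (0 : V) ‖J‖ (by simpa using hu.1) (by simpa using hv.1) ha hb hab
        simpa using this
      · have h1 : Λ u ∈ Metric.closedBall (J Λ) δ := hu.2 Λ hΛ
        have h2 : Λ v ∈ Metric.closedBall (J Λ) δ := hv.2 Λ hΛ
        have := convex_closedBall (J Λ) δ h1 h2 ha hb hab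
        rw [← map_smul, ← map_smul, ← map_add] at this
        exact this
  obtain ⟨x, hx⟩ := key
  refine ⟨x, ?_⟩
  ext Λ
  rw [NormedSpace.dual_def]
  refine eq_of_abs_sub_nonpos (le_of_forall_pos_le_add fun δ hδ => ?_)
  have := (hx ⟨{Λ}, δ, hδ⟩).2 Λ (by simp)
  simpa using this

end Gauge

end WGauss

namespace WGauss

/-! ### Reflexivity and weak compactness of Sobolev spaces -/

section SobolevComplete

variable {X E G : Type*} [MeasurableSpace X]
  [NormedAddCommGroup E] [NormedSpace ℝ E] [NormedAddCommGroup G] [NormedSpace ℝ G]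
  {T : Submodule ℝ (X → E)}

/-- A diagonal argument: a limit of limits of test functions is approximated by test functions up to
2/(n+1). -/
theorem isClosed_sobolev (D : T →ₗ[ℝ] (X → G)) (m : Measure X) (p : ℝ≥0∞) [Fact (1 ≤ p)] :
    IsClosed (Sobolev D m p : Set (WithLp 1 (Lp E p m × Lp G p m))) := by
  have hp : 1 ≤ p := Fact.out
  refine isClosed_of_closure_subset fun z hz => ?_
  set c : ℕ → ℝ≥0∞ := fun n => ((n : ℝ≥0∞) + 1)⁻¹ with hc
  have hc0 : ∀ n, 0 < c n := fun n => ENNReal.inv_pos.2 (by simp)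
  have hct : Tendsto (fun n => c n + c n) atTop (𝓝 0) := by
    have h1 : Tendsto c atTop (𝓝 0) := by
      have := (tendsto_add_atTop_iff_nat 1).2 ENNReal.tendsto_inv_nat_nhds_zero
      simpa [hc] using this
    simpa using h1.add h1
  have H : ∀ n, ∃ u : T, (MemLp (u : X → E) p m ∧ MemLp (D u) p m) ∧
      eLpNorm ((u : X → E) - (z.fst : X → E)) p m ≤ c n + c n ∧ eLpNorm (D u - (z.snd : X → G)) p m ≤ c n + c n := by
    intro n
    obtain ⟨y, hy, hyz⟩ := EMetric.mem_closure_iff.1 hz (c n) (hc0 n)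
    obtain ⟨-, -, u, hu, h3, h4⟩ := hy
    obtain ⟨k, hk1, hk2⟩ := (((h3.eventually (gt_mem_nhds (hc0 n))).and
      (h4.eventually (gt_mem_nhds (hc0 n)))).exists)
    have e1 : eLpNorm ((y.fst : X → E) - (z.fst : X → E)) p m ≤ c n := by
      rw [← Lp.edist_def, edist_comm]
      refine le_trans ?_ hyz.le
      rw [WithLp.prod_edist_eq_of_L1]
      exact le_self_add
    have e2 : eLpNorm ((y.snd : X → G) - (z.snd : X → G)) p m ≤ c n := by
      rw [← Lp.edist_def, edist_comm]
      refine le_trans ?_ hyz.le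
      rw [WithLp.prod_edist_eq_of_L1]
      exact le_add_self
    refine ⟨u k, hu k, ?_, ?_⟩
    · rw [← sub_add_sub_cancel _ (y.fst : X → E)]
      exact (eLpNorm_add_le ((hu k).1.1.sub (Lp.memLp _).1)
        ((Lp.memLp _).1.sub (Lp.memLp _).1) hp).trans (add_le_add hk1.le e1)
    · rw [← sub_add_sub_cancel _ (y.snd : X → G)]
      exact (eLpNorm_add_le ((hu k).2.1.sub (Lp.memLp _).1)
        ((Lp.memLp _).1.sub (Lp.memLp _).1) hp).trans (add_le_add hk2.le e2)
  choose u hu h1 h2 using H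
  exact ⟨Lp.memLp _, Lp.memLp _, u, hu,
    tendsto_of_tendsto_of_tendsto_of_le_of_le tendsto_const_nhds hct (fun _ => zero_le) h1,
    tendsto_of_tendsto_of_tendsto_of_le_of_le tendsto_const_nhds hct (fun _ => zero_le) h2⟩

theorem completeSpace_sobolev [CompleteSpace E] [CompleteSpace G] (D : T →ₗ[ℝ] (X → G))
    (m : Measure X) (p : ℝ≥0∞) [Fact (1 ≤ p)] : CompleteSpace (Sobolev D m p) :=
  (isClosed_sobolev D m p).completeSpace_coe

end SobolevComplete

section LpNorm

theorem integral_norm_rpow_eq {Ω E : Type*} [MeasurableSpace Ω] {m : Measure Ω}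
    [NormedAddCommGroup E] {p : ℝ} (hp : 0 < p) {f : Ω → E} (hf : MemLp f (ENNReal.ofReal p) m) :
    ∫ x, ‖f x‖ ^ p ∂m = (eLpNorm f (ENNReal.ofReal p) m).toReal ^ p := by
  have h0 : 0 ≤ ∫ x, ‖f x‖ ^ p ∂m := integral_nonneg fun x => by positivity
  rw [hf.eLpNorm_eq_integral_rpow_norm (by simpa using hp) (by simp), ENNReal.toReal_ofReal hp.le,
    ENNReal.toReal_ofReal (by positivity), ← Real.rpow_mul h0, inv_mul_cancel₀ hp.ne',
    Real.rpow_one]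

theorem Lp_norm_sub_rpow_le {p ε K : ℝ} (hp : 1 < p)
    (hK : ∀ α β d m : ℝ, 0 ≤ α → 0 ≤ β → 0 ≤ d → 0 ≤ m → |α - β| ≤ d → d ≤ α + β →
      m ^ 2 = (α ^ 2 + β ^ 2) / 2 - d ^ 2 / 4 →
      d ^ p ≤ ε * (α ^ p + β ^ p) + K * ((α ^ p + β ^ p) / 2 - m ^ p))
    {Ω E : Type*} [MeasurableSpace Ω] {m : Measure Ω} [NormedAddCommGroup E]
    [InnerProductSpace ℝ E] [Fact (1 ≤ ENNReal.ofReal p)] (f g : Lp E (ENNReal.ofReal p) m) :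
    ‖f - g‖ ^ p ≤ ε * (‖f‖ ^ p + ‖g‖ ^ p)
      + K * ((‖f‖ ^ p + ‖g‖ ^ p) / 2 - ‖(1 / 2 : ℝ) • (f + g)‖ ^ p) := by
  have hp0 : 0 < p := by linarith
  have key := integral_norm_sub_rpow_le hp hK (Lp.memLp f) (Lp.memLp g)
  have e : ∀ (h : Lp E (ENNReal.ofReal p) m) (k : Ω → E), h =ᵐ[m] k →
      ∫ x, ‖k x‖ ^ p ∂m = ‖h‖ ^ p := by
    intro h k hk
    rw [Lp.norm_def, ← integral_norm_rpow_eq hp0 (Lp.memLp h)]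
    refine integral_congr_ae ?_
    filter_upwards [hk] with x hx
    rw [hx]
  rw [e f f EventuallyEq.rfl, e g g EventuallyEq.rfl, e (f - g) (fun x => f x - g x)
    (Lp.coeFn_sub f g), e ((1 / 2 : ℝ) • (f + g)) (fun x => (1 / 2 : ℝ) • (f x + g x)) ?_] at key
  · exact key
  · filter_upwards [Lp.coeFn_smul (1 / 2 : ℝ) (f + g), Lp.coeFn_add f g] with x h1 h2
    rw [h1, Pi.smul_apply, h2, Pi.add_apply]

end LpNorm

/-! ### Uniform convexity of the Sobolev gauge and its two consequences -/

section SobolevGauge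

variable {X E G : Type*} [MeasurableSpace X]
  [NormedAddCommGroup E] [InnerProductSpace ℝ E] [NormedAddCommGroup G] [InnerProductSpace ℝ G]
  {T : Submodule ℝ (X → E)}

/-- The graph norm is an ℓ¹ sum, in general not even strictly convex, whence the sum of p-th powers
as gauge. -/
theorem isUniformlyConvexGauge_sobolev (D : T →ₗ[ℝ] (X → G)) (m : Measure X) {p : ℝ} (hp : 1 < p)
    [Fact (1 ≤ ENNReal.ofReal p)] :
    IsUniformlyConvexGauge fun z : Sobolev D m (ENNReal.ofReal p) =>
      ‖z.1.fst‖ ^ p + ‖z.1.snd‖ ^ p := by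
  have hp0 : 0 < p := by linarith
  have hnorm : ∀ z : Sobolev D m (ENNReal.ofReal p), ‖z‖ = ‖z.1.fst‖ + ‖z.1.snd‖ := fun z =>
    WithLp.prod_norm_eq_of_L1 z.1
  refine ⟨fun v => by positivity, fun r => ⟨r ^ p + r ^ p, fun v hv => ?_⟩, fun R η hη => ?_⟩
  · rw [hnorm] at hv
    have h1 := norm_nonneg v.1.fst
    have h2 := norm_nonneg v.1.snd
    exact add_le_add (Real.rpow_le_rpow h1 (by linarith) hp0.le)
      (Real.rpow_le_rpow h2 (by linarith) hp0.le)
  · set κ : ℝ := (η / 3) ^ p with hκ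
    have hκ0 : 0 < κ := by positivity
    -- On the sublevel set the ε-term is at most κ/2, and the gap κ/(2(K+1)) keeps the K-term below
    -- κ/2. With κ = (η/3)^p both components differ by at most η/3, so the distance is at most 2η/3
    -- < η.
    set ε : ℝ := κ / (4 * (|R| + 1)) with hε
    obtain ⟨K, hK0, hK⟩ := exists_uniformConvexity_const hp (ε := ε) (by positivity)
    refine ⟨κ / (2 * (K + 1)), by positivity, fun u v hu hv huv => ?_⟩
    have h1 := Lp_norm_sub_rpow_le hp hK u.1.fst v.1.fst
    have h2 := Lp_norm_sub_rpow_le hp hK u.1.snd v.1.snd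
    have e1 : ((1 / 2 : ℝ) • (u + v)).1.fst = (1 / 2 : ℝ) • (u.1.fst + v.1.fst) := rfl
    have e2 : ((1 / 2 : ℝ) • (u + v)).1.snd = (1 / 2 : ℝ) • (u.1.snd + v.1.snd) := rfl
    simp only [e1, e2] at huv
    have hsum : ‖u.1.fst - v.1.fst‖ ^ p + ‖u.1.snd - v.1.snd‖ ^ p ≤ κ := by
      have h3 : ε * (‖u.1.fst‖ ^ p + ‖u.1.snd‖ ^ p + (‖v.1.fst‖ ^ p + ‖v.1.snd‖ ^ p))
          ≤ κ / 2 := by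
        calc _ ≤ ε * (2 * (|R| + 1)) := by
              refine mul_le_mul_of_nonneg_left ?_ (by positivity)
              have := le_abs_self R
              linarith
          _ = κ / 2 := by
              rw [hε]
              field_simp
              ring
      have h4 := mul_le_mul_of_nonneg_left huv hK0
      have h5 : K * (κ / (2 * (K + 1))) ≤ κ / 2 := by
        rw [mul_div_assoc', div_le_div_iff₀ (by positivity) (by positivity)]
        nlinarith
      linarith
    have hsmall : ∀ a : ℝ, 0 ≤ a → a ^ p ≤ κ → a ≤ η / 3 := fun a ha h =>
      (Real.rpow_le_rpow_iff ha (by positivity) hp0).1 h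
    have h6 := hsmall ‖u.1.fst - v.1.fst‖ (norm_nonneg _)
      (le_trans (le_add_of_nonneg_right (by positivity)) hsum)
    have h7 := hsmall ‖u.1.snd - v.1.snd‖ (norm_nonneg _)
      (le_trans (le_add_of_nonneg_left (by positivity)) hsum)
    rw [dist_eq_norm, hnorm]
    have e3 : (u - v).1.fst = u.1.fst - v.1.fst := rfl
    have e4 : (u - v).1.snd = u.1.snd - v.1.snd := rfl
    rw [e3, e4]
    linarith

theorem isReflexive_sobolevSpace [CompleteSpace E] [CompleteSpace G] (D : T →ₗ[ℝ] (X → G))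
    (m : Measure X) {p : ℝ} (hp : 1 < p) [Fact (1 ≤ ENNReal.ofReal p)] :
    IsReflexive (SobolevSpace D m (ENNReal.ofReal p)) := by
  have := completeSpace_sobolev D m (ENNReal.ofReal p)
  exact (isUniformlyConvexGauge_sobolev D m hp).isReflexive

/-- Pointwise limits of bounded sequences of Sobolev functions are Sobolev functions. -/
theorem memW_of_tendsto_ae [CompleteSpace E] [CompleteSpace G] {D : T →ₗ[ℝ] (X → G)}
    {m : Measure X} {p : ℝ} (hp : 1 < p) {φ : ℕ → X → E} {Φ : ℕ → X → G} {φ₀ : X → E} {C : ℝ≥0}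
    (h : ∀ n, HasGrad D m (ENNReal.ofReal p) (φ n) (Φ n))
    (hC : ∀ n, wNorm m (ENNReal.ofReal p) (φ n) (Φ n) ≤ C)
    (hlim : ∀ᵐ x ∂m, Tendsto (fun n => φ n x) atTop (𝓝 (φ₀ x))) :
    MemW D m (ENNReal.ofReal p) φ₀ := by
  have hfact : Fact (1 ≤ ENNReal.ofReal p) := ⟨by simpa using hp.le⟩
  have := completeSpace_sobolev D m (ENNReal.ofReal p)
  set z : ℕ → Sobolev D m (ENNReal.ofReal p) := fun n =>
    ⟨WithLp.toLp 1 ((h n).1.toLp, (h n).2.1.toLp),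
      (h n).congr (h n).1.coeFn_toLp.symm (h n).2.1.coeFn_toLp.symm⟩ with hz
  have hz1 : ∀ n, (z n).1.fst =ᵐ[m] φ n := fun n => (h n).1.coeFn_toLp
  have hzn : ∀ n, ‖z n‖ ≤ C := fun n => by
    have e : ‖z n‖ = ‖(z n).1.fst‖ + ‖(z n).1.snd‖ := WithLp.prod_norm_eq_of_L1 (z n).1
    have e1 : ‖(z n).1.fst‖ = (eLpNorm (φ n) (ENNReal.ofReal p) m).toReal :=
      Lp.norm_toLp _ (h n).1
    have e2 : ‖(z n).1.snd‖ = (eLpNorm (Φ n) (ENNReal.ofReal p) m).toReal :=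
      Lp.norm_toLp _ (h n).2.1
    rw [e, e1, e2, ← ENNReal.toReal_add (h n).1.2.ne (h n).2.1.2.ne]
    exact ENNReal.toReal_mono ENNReal.coe_ne_top (hC n)
  -- Closed convex hulls of the tails of φ k (x). Requiring v x to lie in A n x almost everywhere is
  -- a closed convex condition satisfied by z n, and it plays the part of Mazur's lemma.
  set A : ℕ → X → Set E := fun n x => closure (convexHull ℝ {y | ∃ k, n ≤ k ∧ φ k x = y}) with hA
  set S : ℕ → Set (Sobolev D m (ENNReal.ofReal p)) := fun n =>
    {v | ‖v‖ ≤ C ∧ ∀ᵐ x ∂m, (v.1.fst : X → E) x ∈ A n x} with hS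
  have key : ∃ v, ∀ n, v ∈ S n := by
    refine (isUniformlyConvexGauge_sobolev D m hp).exists_forall_mem (r := C) ?_ ?_ ?_ ?_
      fun n v hv => hv.1
    · refine directed_of_isDirected_le fun i j hij v hv => ⟨hv.1, ?_⟩
      filter_upwards [hv.2] with x hx
      refine closure_mono (convexHull_mono ?_) hx
      rintro y ⟨k, hk, rfl⟩
      exact ⟨k, hij.trans hk, rfl⟩
    · intro n
      refine ⟨z n, hzn n, ?_⟩
      filter_upwards [hz1 n] with x hx
      rw [hx]
      exact subset_closure (subset_convexHull ℝ _ ⟨n, le_rfl, rfl⟩)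
    · intro n
      refine isClosed_of_closure_subset fun v hv => ?_
      obtain ⟨y, hy, hyv⟩ := mem_closure_iff_seq_limit.1 hv
      refine ⟨le_of_tendsto' hyv.norm fun k => (hy k).1, ?_⟩
      have hfst : Tendsto (fun k => (y k).1.fst) atTop (𝓝 v.1.fst) :=
        (((WithLp.continuous_fst 1 _ _).comp continuous_subtype_val).tendsto v).comp hyv
      obtain ⟨ns, -, hns⟩ := (tendstoInMeasure_of_tendsto_Lp hfst).exists_seq_tendsto_ae
      filter_upwards [hns, ae_all_iff.2 fun k => (hy (ns k)).2] with x hx1 hx2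
      exact isClosed_closure.mem_of_tendsto hx1 (Eventually.of_forall hx2)
    · intro n u hu v hv a b ha hb hab
      refine ⟨?_, ?_⟩
      · have := convex_closedBall (0 : Sobolev D m (ENNReal.ofReal p)) C (by simpa using hu.1)
          (by simpa using hv.1) ha hb hab
        simpa using this
      · have e : (a • u + b • v).1.fst = a • u.1.fst + b • v.1.fst := rfl
        rw [e]
        filter_upwards [hu.2, hv.2, Lp.coeFn_add (a • u.1.fst) (b • v.1.fst),
          Lp.coeFn_smul a u.1.fst, Lp.coeFn_smul b v.1.fst] with x h1 h2 h3 h4 h5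
        rw [h3, Pi.add_apply, h4, h5]
        exact (convex_convexHull ℝ _).closure h1 h2 ha hb hab
  obtain ⟨v, hv⟩ := key
  refine ⟨v.1.snd, HasGrad.congr v.2 ?_ EventuallyEq.rfl⟩
  filter_upwards [hlim, ae_all_iff.2 fun n => (hv n).2] with x hx1 hx2
  -- The hulls of the tails shrink to φ₀ x, so the common point v has first component φ₀, and its
  -- second component is a gradient.
  refine eq_of_forall_dist_le fun ε hε => ?_
  obtain ⟨n, hn⟩ := Metric.tendsto_atTop.1 hx1 ε hε
  have hsub : A n x ⊆ Metric.closedBall (φ₀ x) ε := by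
    refine closure_minimal (convexHull_min ?_ (convex_closedBall _ _)) Metric.isClosed_closedBall
    rintro y ⟨k, hk, rfl⟩
    exact (hn k hk).le
  exact hsub (hx2 n)

end SobolevGauge

end WGauss

namespace WGauss

/-! ### The product rule -/

/-- Hölder on each term of uV - φΨ = (u - φ)(V - Ψ) + (u - φ)Ψ + φ(V - Ψ). -/
theorem tendsto_eLpNorm_smul {X E : Type*} [MeasurableSpace X] {m : Measure X}
    [NormedAddCommGroup E] [NormedSpace ℝ E] {p q c : ℝ≥0∞} [ENNReal.HolderTriple p q c]
    (hc : 1 ≤ c) {u : ℕ → X → ℝ} {φ : X → ℝ} {V : ℕ → X → E} {Ψ : X → E}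
    (hu : ∀ n, MemLp (u n) p m) (hφ : MemLp φ p m) (hV : ∀ n, MemLp (V n) q m)
    (hΨ : MemLp Ψ q m) (h1 : Tendsto (fun n => eLpNorm (u n - φ) p m) atTop (𝓝 0))
    (h2 : Tendsto (fun n => eLpNorm (V n - Ψ) q m) atTop (𝓝 0)) :
    Tendsto (fun n => eLpNorm (u n • V n - φ • Ψ) c m) atTop (𝓝 0) := by
  have t1 : Tendsto (fun n => eLpNorm (u n - φ) p m * eLpNorm (V n - Ψ) q m) atTop (𝓝 0) := by
    simpa using ENNReal.Tendsto.mul h1 (Or.inr ENNReal.zero_ne_top) h2 (Or.inr ENNReal.zero_ne_top)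
  have t2 : Tendsto (fun n => eLpNorm (u n - φ) p m * eLpNorm Ψ q m) atTop (𝓝 0) := by
    simpa using ENNReal.Tendsto.mul_const h1 (Or.inr hΨ.2.ne)
  have t3 : Tendsto (fun n => eLpNorm φ p m * eLpNorm (V n - Ψ) q m) atTop (𝓝 0) := by
    simpa using ENNReal.Tendsto.const_mul h2 (Or.inr hφ.2.ne)
  refine tendsto_of_tendsto_of_tendsto_of_le_of_le tendsto_const_nhds
    (by simpa using (t1.add t2).add t3) (fun _ => zero_le) fun n => ?_
  have e : u n • V n - φ • Ψ = (u n - φ) • (V n - Ψ) + (u n - φ) • Ψ + φ • (V n - Ψ) := by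
    simp only [sub_smul, smul_sub]
    abel
  have m1 := ((hu n).1.sub hφ.1)
  have m2 := ((hV n).1.sub hΨ.1)
  rw [e]
  refine (eLpNorm_add_le ((m1.smul m2).add (m1.smul hΨ.1)) (hφ.1.smul m2) hc).trans ?_
  refine add_le_add ((eLpNorm_add_le (m1.smul m2) (m1.smul hΨ.1) hc).trans ?_) ?_
  · exact add_le_add (eLpNorm_smul_le_mul_eLpNorm m2 m1) (eLpNorm_smul_le_mul_eLpNorm hΨ.1 m1)
  · exact eLpNorm_smul_le_mul_eLpNorm m2 hφ.1

section Product

variable {X : Type*} [NormedAddCommGroup X] [NormedSpace ℝ X] [CompleteSpace X]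
  [SecondCountableTopology X] [MeasurableSpace X] [BorelSpace X]
  (μ : Measure X) [IsGaussian μ]

/-- Products of approximants are again cylindrical, so the Leibniz rule holds for them exactly and
passes to the limit. -/
theorem HasGrad.mul {m : Measure X} {p q c : ℝ≥0∞} [ENNReal.HolderTriple p q c] (hc : 1 ≤ c)
    {φ ψ : X → ℝ} {Φ Ψ : X → CM μ} (h : HasGrad (gradOp μ) m p φ Φ)
    (h' : HasGrad (gradOp μ) m q ψ Ψ) :
    HasGrad (gradOp μ) m c (fun x => φ x * ψ x) (fun x => φ x • Ψ x + ψ x • Φ x) := by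
  have hsymm : ENNReal.HolderTriple q p c := ENNReal.HolderTriple.symm
  obtain ⟨h1, h2, u, hu, h3, h4⟩ := h
  obtain ⟨h1', h2', v, hv, h3', h4'⟩ := h'
  have hcu : ∀ n, IsSmoothCylindrical (u n : X → ℝ) := fun n => isSmoothCylindrical_of_mem (u n).2
  have hcv : ∀ n, IsSmoothCylindrical (v n : X → ℝ) := fun n => isSmoothCylindrical_of_mem (v n).2
  set y : ℕ → cylindrical X ℝ := fun n =>
    ⟨fun x => (u n : X → ℝ) x * (v n : X → ℝ) x, ((hcu n).mul (hcv n)).mem_cylindrical⟩ with hy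
  have hD : ∀ n, gradOp μ (y n)
      = (u n : X → ℝ) • gradOp μ (v n) + (v n : X → ℝ) • gradOp μ (u n) := fun n =>
    funext fun x => gradH_mul μ (hcu n).contDiff (hcv n).contDiff x
  refine ⟨h1'.smul h1, (h2'.smul h1).add (h2.smul h1'), y, fun n => ⟨(hv n).1.smul (hu n).1, ?_⟩,
    ?_, ?_⟩
  · rw [hD]
    exact ((hv n).2.smul (hu n).1).add ((hu n).2.smul (hv n).1)
  · exact tendsto_eLpNorm_smul hc (fun n => (hu n).1) h1 (fun n => (hv n).1) h1' h3 h3'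
  · have t1 := tendsto_eLpNorm_smul hc (fun n => (hu n).1) h1 (fun n => (hv n).2) h2' h3 h4'
    have t2 := tendsto_eLpNorm_smul hc (fun n => (hv n).1) h1' (fun n => (hu n).2) h2 h3' h4
    refine tendsto_of_tendsto_of_tendsto_of_le_of_le tendsto_const_nhds
      (by simpa using t1.add t2) (fun _ => zero_le) fun n => ?_
    have e : gradOp μ (y n) - (fun x => φ x • Ψ x + ψ x • Φ x)
        = ((u n : X → ℝ) • gradOp μ (v n) - φ • Ψ)
          + ((v n : X → ℝ) • gradOp μ (u n) - ψ • Φ) := by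
      rw [hD]
      exact add_sub_add_comm _ _ _ _
    simp only [e]
    exact eLpNorm_add_le (((hu n).1.1.smul (hv n).2.1).sub (h1.1.smul h2'.1))
      (((hv n).1.1.smul (hu n).2.1).sub (h1'.1.smul h2.1)) hc

theorem HasGrad.of_hessOp {ι : Type*} {e : HilbertBasis ι ℝ (CM μ)} {m : Measure X} {p : ℝ≥0∞}
    {F : X → ℝ} {Φ : X → CM μ × HS μ e (CM μ)} (h : HasGrad (hessOp μ e) m p F Φ) :
    HasGrad (gradOp μ) m p F (fun x => (Φ x).1) := by
  obtain ⟨h1, h2, u, hu, h3, h4⟩ := h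
  set S : CM μ × HS μ e (CM μ) →L[ℝ] CM μ := ContinuousLinearMap.fst ℝ _ _ with hS
  have hD : ∀ n, (fun x => S (hessOp μ e (u n) x)) = gradOp μ (u n) := fun n => by
    funext x
    rw [hS, ContinuousLinearMap.coe_fst']
    rfl
  have hΦ : (fun x => S (Φ x)) = fun x => (Φ x).1 := by
    funext x
    rw [hS, ContinuousLinearMap.coe_fst']
  rw [← hΦ]
  refine ⟨h1, h2.continuousLinearMap_comp S, u, fun n => ⟨(hu n).1, ?_⟩, h3, ?_⟩
  · rw [← hD]
    exact (hu n).2.continuousLinearMap_comp S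
  · have := tendsto_eLpNorm_clm_comp S h4
    simpa only [hD] using this

end Product

end WGauss

/-! ### Proof of the proposition -/

theorem proposition2p5
    {X : Type*} [NormedAddCommGroup X] [NormedSpace ℝ X] [CompleteSpace X]
    [SecondCountableTopology X] [MeasurableSpace X] [BorelSpace X]
    -- a non-degenerate centered Gaussian measure, and an orthonormal basis of `H`
    (μ : Measure X) [IsGaussian μ]
    (hcentered : ∀ l : StrongDual ℝ X, ∫ x, l x ∂μ = 0)
    (hnondeg : ∀ l : StrongDual ℝ X, l ≠ 0 → 0 < Var[l; μ])
    {ι : Type*} (e : HilbertBasis ι ℝ (WGauss.CM μ))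
    -- the weight and the weighted measure
    (s s' t : ℝ) (hs : s.HolderConjugate s') (ht : s' < t)
    (w : X → ℝ) (hwpos : ∀ᵐ x ∂μ, 0 < w x)
    (hw : WGauss.MemW (WGauss.gradOp μ) μ (ENNReal.ofReal s) w)
    (hlogw : WGauss.MemW (WGauss.gradOp μ) μ (ENNReal.ofReal t) (fun x => Real.log (w x)))
    (ν : Measure X) (hν : ν = WGauss.weighted μ w)
    (p : ℝ) (hp : t / (t - s') ≤ p) :
    -- the spaces `W^{1,p}(X, ν)` and `W^{1,p}(X, ν; H)` are well defined
    (WGauss.Closable (WGauss.gradOp μ) ν (ENNReal.ofReal p) ∧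
      WGauss.Closable (WGauss.gradOpV μ e (WGauss.CM μ)) ν (ENNReal.ofReal p)) ∧
    -- reflexivity
    (∃ _ : Fact (1 ≤ ENNReal.ofReal p),
      WGauss.IsReflexive (WGauss.SobolevSpace (WGauss.gradOp μ) ν (ENNReal.ofReal p))) ∧
    -- embedding of the Gaussian Sobolev spaces
    ((∀ q : ℝ, p * s' < q →
        WGauss.Embeds (WGauss.gradOp μ) μ (ENNReal.ofReal q) ν (ENNReal.ofReal p) ∧
        WGauss.Embeds (WGauss.gradOpV μ e (WGauss.CM μ)) μ (ENNReal.ofReal q)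
          ν (ENNReal.ofReal p)) ∧
      (∀ G : X → ℝ,
        (∀ q : ℝ, 1 < q → WGauss.MemW (WGauss.hessOp μ e) μ (ENNReal.ofReal q) G) →
        ∀ b : ℝ, t / (t - s') ≤ b →
          WGauss.MemW (WGauss.gradOp μ) ν (ENNReal.ofReal b) G)) ∧
    -- embedding in the Gaussian Sobolev spaces
    (∀ r : ℝ, 0 < r → r < 1 → Integrable (fun x => w x ^ (r / (r - 1))) μ →
      WGauss.Embeds (WGauss.gradOp μ) ν (ENNReal.ofReal p) μ (ENNReal.ofReal (p * r)) ∧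
      WGauss.Embeds (WGauss.gradOpV μ e (WGauss.CM μ)) ν (ENNReal.ofReal p)
        μ (ENNReal.ofReal (p * r))) ∧
    -- pointwise limits of bounded sequences
    (∀ (φ : ℕ → X → ℝ) (Φ : ℕ → X → WGauss.CM μ) (φ₀ : X → ℝ) (C : ℝ≥0),
      (∀ n, WGauss.HasGrad (WGauss.gradOp μ) ν (ENNReal.ofReal p) (φ n) (Φ n)) →
      (∀ n, WGauss.wNorm ν (ENNReal.ofReal p) (φ n) (Φ n) ≤ C) →
      (∀ᵐ x ∂ν, Tendsto (fun n => φ n x) atTop (𝓝 (φ₀ x))) →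
      WGauss.MemW (WGauss.gradOp μ) ν (ENNReal.ofReal p) φ₀) ∧
    -- product rule
    (∀ q : ℝ, t / (t - s') ≤ q → t / (t - s') ≤ p * q / (p + q) →
      ∀ (φ ψ : X → ℝ) (Φ Ψ : X → WGauss.CM μ),
        WGauss.HasGrad (WGauss.gradOp μ) ν (ENNReal.ofReal p) φ Φ →
        WGauss.HasGrad (WGauss.gradOp μ) ν (ENNReal.ofReal q) ψ Ψ →
        ∀ r : ℝ, t / (t - s') ≤ r → r ≤ p * q / (p + q) →
          WGauss.HasGrad (WGauss.gradOp μ) ν (ENNReal.ofReal r)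
            (fun x => φ x * ψ x) (fun x => φ x • Ψ x + ψ x • Φ x)) := by
  have hs'1 : 1 < s' := hs.symm.lt
  have hts : 0 < t - s' := by linarith
  -- As s' > 0, the threshold t/(t-s') exceeds 1, which puts every exponent in the uniformly convex
  -- range.
  have hpos : ∀ a : ℝ, t / (t - s') ≤ a → 1 < a := fun a ha =>
    lt_of_lt_of_le ((one_lt_div hts).2 (by linarith)) ha
  have hp1 : 1 < p := hpos p hp
  obtain ⟨Φw, hΦw⟩ := hw
  obtain ⟨Ψ, hΨ⟩ := hlogw
  have hwL : MemLp w (ENNReal.ofReal s) μ := hΦw.1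
  have hwm : AEMeasurable w μ := hwL.1.aemeasurable
  have hw1 : Integrable w μ := hwL.integrable (by simpa using hs.lt.le)
  have hμν : μ ≪ ν := hν ▸ WGauss.absolutelyContinuous_weighted hwm hwpos
  have hfin : IsFiniteMeasure ν := hν ▸ WGauss.isFiniteMeasure_weighted hw1
  have hle : ∀ a q : ℝ, 0 < a → a * s' ≤ q →
      ∃ C, WGauss.LpLe μ (ENNReal.ofReal q) ν (ENNReal.ofReal a) C := by
    intro a q ha haq
    obtain ⟨C, hC⟩ := WGauss.lpLe_weighted hs hwL ha
    obtain ⟨C', hC'⟩ := WGauss.lpLe_of_exponent_le μ (ENNReal.ofReal_le_ofReal haq)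
    exact ⟨_, hC'.trans (hν ▸ hC)⟩
  refine ⟨?_, ?_, ⟨?_, ?_⟩, ?_, ?_, ?_⟩
  · have hconj : p.HolderConjugate (p / (p - 1)) := Real.HolderConjugate.conjExponent hp1
    have hconj' : ENNReal.HolderConjugate (ENNReal.ofReal p) (ENNReal.ofReal (p / (p - 1))) :=
      hconj.ennrealOfReal
    have hβ : ∀ l, MemLp (WGauss.logDeriv μ Ψ l) (ENNReal.ofReal (p / (p - 1))) ν := by
      intro l
      -- The required inequality p's' ≤ t, with p' = p/(p-1), is equivalent to p ≥ t/(t-s').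
      obtain ⟨C, hC⟩ := hle (p / (p - 1)) t hconj.symm.pos (by
        rw [div_le_iff₀ hts] at hp
        rw [div_mul_eq_mul_div, div_le_iff₀ (by linarith)]
        linarith)
      exact hC.memLp (WGauss.memLp_logDeriv μ ENNReal.ofReal_ne_top hΨ.2.1 l)
    have hibp : ∀ l, ∀ f : X → ℝ, WGauss.IsSmoothCylindrical f →
        ∫ x, inner ℝ (WGauss.gradH μ f x) (WGauss.toH μ l) ∂ν
          = ∫ x, f x * WGauss.logDeriv μ Ψ l x ∂ν := by
      intro l f hf
      rw [hν]
      exact WGauss.integral_inner_gradH_weighted μ hcentered hs ht.le hwpos hwL hΨ hf l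
    exact ⟨WGauss.closable_gradOp μ hβ hibp, WGauss.closable_gradOpV μ e hβ hibp⟩
  · have hfact : Fact (1 ≤ ENNReal.ofReal p) := ⟨by simpa using hp1.le⟩
    exact ⟨hfact, WGauss.isReflexive_sobolevSpace _ ν hp1⟩
  · intro q hq
    obtain ⟨C, hC⟩ := hle p q (by linarith) hq.le
    exact ⟨hC.embeds hμν _, hC.embeds hμν _⟩
  · intro G hG b hb
    have hb1 := hpos b hb
    -- The endpoint exponent b s' is allowed in `hle` and is greater than 1, so it can be used
    -- directly.
    obtain ⟨A, hA⟩ := hG (b * s') (by nlinarith)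
    obtain ⟨C, hC⟩ := hle b (b * s') (by linarith) le_rfl
    exact ⟨_, (WGauss.HasGrad.of_hessOp μ hA).transfer hC⟩
  · intro r hr0 hr1 hint
    obtain ⟨C, hC⟩ := WGauss.weighted_lpLe hwm hwpos hr0 hr1 hint (show 0 < p by linarith)
    rw [← hν] at hC
    have hνμ : ν ≪ μ := hν ▸ WGauss.weighted_absolutelyContinuous μ w
    exact ⟨hC.embeds hνμ _, hC.embeds hνμ _⟩
  · intro φ Φ φ₀ C h hC hlim
    exact WGauss.memW_of_tendsto_ae hp1 h hC hlim
  · intro q hq hpq φ ψ Φ Ψ' hφ hψ r hr hrpq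
    have hq1 := hpos q hq
    have hr1 := hpos r hr
    have hp0 : 0 < p := by linarith
    have hq0 : 0 < q := by linarith
    -- The largest exponent pq/(p+q) comes from Hölder; smaller r follow because ν is finite.
    have hc : Real.HolderTriple p q (p * q / (p + q)) := ⟨by field_simp; ring, hp0, hq0⟩
    have hc' := hc.ennrealOfReal
    obtain ⟨C, hC⟩ := WGauss.lpLe_of_exponent_le ν (ENNReal.ofReal_le_ofReal hrpq)
    exact (WGauss.HasGrad.mul μ (by simpa using (hr1.trans_le hrpq).le) hφ hψ).transfer hC
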